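/- Let $n,m\in\mathbb N$, $T>0$, let $U\subset\mathbb R^m$ be nonempty, connected and compact, $\xi\in\mathbb R^n$, and let $f(t,x,u)\in\mathbb R^n$ and $\Psi(x)\in\mathbb R$ be such that $\Psi$ is differentiable on $\mathbb R^n$, $f$ has partial derivatives $\partial f/\partial x$ and $\partial f/\partial u$ at the points of $[0,T]\times\mathbb R^n\times U$, and $\Psi$, $\partial\Psi/\partial x$, and (on $[0,T]\times\mathbb R^n\times U$, jointly in $(t,x,u)$) $f$, $\partial f/\partial x$, $\partial f/\partial u$ are Lipschitz continuous. All differential equations below are understood in the Carathéodory sense (absolutely continuous solutions on $[0,T]$, equation for a.e. $t$). Relaxed problem: minimize $\Psi(x(T))$ over the set $\mathcal X$ of pairs $(x,\mu)$, where $\mu=(\mu_t)_{t\in[0,T]}$ is a measurable family of Borel probability measures on $\mathbb R^m$ with $\operatorname{supp}\mu_t\subset U$ for a.e. $t$, and $$x(0)=\xi,\qquad \dot x(t)=\int f(t,x(t),u)\,d\mu_t(u).$$ For $(x,\mu)\in\mathcal X$ call a measurable family $\delta\mu=(\delta\mu_t)_{t\in[0,T]}$ of finite signed Borel measures on $\mathbb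 R^m$ admissible if for a.e. $t$: $\operatorname{supp}(\delta\mu_t+\mu_t)\subset U$, $\delta\mu_t+\mu_t\ge 0$ and $\int d\delta\mu_t=0$. Define $$\theta_l(x,\mu)=\min_{\delta x,\,\delta\mu}\ \frac{\partial\Psi}{\partial x}(x(T))^{\top}\delta x(T)$$ over admissible $\delta\mu$ and $\delta x$ satisfying $$\delta x(0)=0,\qquad \dot{\delta x}(t)=\int\frac{\partial f}{\partial x}(t,x(t),u)\,d\mu_t(u)\,\delta x(t)+\int f(t,x(t),u)\,d\delta\mu_t(u),$$ and $$\theta_h(x,\mu)=\min_{\delta\mu}\ \int_0^T p(t)^{\top}\!\int f(t,x(t),u)\,d\delta\mu_t(u)\,dt$$ over admissible $\delta\mu$, where the costate $p$ is defined on $[0,T]$ by $$p(T)=\frac{\partial\Psi}{\partial x}(x(T)),\qquad \dot p(t)=-\int\frac{\partial f}{\partial x}(t,x(t),u)^{\top}d\mu_t(u)\,p(t).$$ Then $\theta_l$ and $\theta_h$ are well defined on $\mathcal X$ (the costate exists and is unique on $[0,T]$, and both minima are attained), and they are optimality functions of the relaxed problem: $\theta_l(x,\mu)\le 0$ and $\theta_h(x,\mu)\le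 0$ for every $(x,\mu)\in\mathcal X$, and $\theta_l(\hat x,\hat\mu)=\theta_h(\hat x,\hat\mu)=0$ for every minimizer $(\hat x,\hat\mu)$ of the relaxed problem. -/

import Mathlib

open MeasureTheory Set

/-- The data of an input-constrained optimal control problem with state space `ℝⁿ` and input
space `ℝᵐ`: the horizon `T`, the input set `U`, the initial state `ξ`, the vector field
`f t x u` and the final cost `Ψ`. -/
structure ControlProblem (n m : ℕ) where
  T : ℝ
  U : Set (EuclideanSpace ℝ (Fin m))
  ξ : EuclideanSpace ℝ (Fin n)
  f : ℝ → EuclideanSpace ℝ (Fin n) → EuclideanSpace ℝ (Fin m) → EuclideanSpace ℝ (Fin n)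
  Ψ : EuclideanSpace ℝ (Fin n) → ℝ

namespace ControlProblem

variable {n m : ℕ}

/-- The partial derivative `∂f/∂x (t, x, u)`. -/
noncomputable def dfx (P : ControlProblem n m) (t : ℝ) (x : EuclideanSpace ℝ (Fin n))
    (u : EuclideanSpace ℝ (Fin m)) : EuclideanSpace ℝ (Fin n) →L[ℝ] EuclideanSpace ℝ (Fin n) :=
  fderiv ℝ (fun y => P.f t y u) x

/-- The partial derivative `∂f/∂u (t, x, u)`. -/
noncomputable def dfu (P : ControlProblem n m) (t : ℝ) (x : EuclideanSpace ℝ (Fin n))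
    (u : EuclideanSpace ℝ (Fin m)) : EuclideanSpace ℝ (Fin m) →L[ℝ] EuclideanSpace ℝ (Fin n) :=
  fderiv ℝ (fun w => P.f t x w) u

/-- `f` and `Ψ` are Lipschitz continuously differentiable: the derivatives exist, and one constant
`L` is a Lipschitz constant of `Ψ`, `∂Ψ/∂x`, `f`, `∂f/∂x` and `∂f/∂u` on `[0,T] × ℝⁿ × U`
(Euclidean norms and the operator norms they induce). -/
structure LipschitzDifferentiable (P : ControlProblem n m) : Prop where
  diff_cost : ∀ x, DifferentiableAt ℝ P.Ψ x
  diff_state : ∀ t ∈ Icc 0 P.T, ∀ x, ∀ u ∈ P.U, DifferentiableAt ℝ (fun y => P.f t y u) x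
  diff_input : ∀ t ∈ Icc 0 P.T, ∀ x, ∀ u ∈ P.U, DifferentiableAt ℝ (fun w => P.f t x w) u
  lipschitz : ∃ L : ℝ, 0 < L ∧
    (∀ x₁ x₂, |P.Ψ x₁ - P.Ψ x₂| ≤ L * ‖x₁ - x₂‖) ∧
    (∀ x₁ x₂, ‖fderiv ℝ P.Ψ x₁ - fderiv ℝ P.Ψ x₂‖ ≤ L * ‖x₁ - x₂‖) ∧
    (∀ t₁ ∈ Icc 0 P.T, ∀ t₂ ∈ Icc 0 P.T, ∀ x₁ x₂, ∀ u₁ ∈ P.U, ∀ u₂ ∈ P.U,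
      ‖P.f t₁ x₁ u₁ - P.f t₂ x₂ u₂‖ ≤ L * (|t₁ - t₂| + ‖x₁ - x₂‖ + ‖u₁ - u₂‖)) ∧
    (∀ t₁ ∈ Icc 0 P.T, ∀ t₂ ∈ Icc 0 P.T, ∀ x₁ x₂, ∀ u₁ ∈ P.U, ∀ u₂ ∈ P.U,
      ‖P.dfx t₁ x₁ u₁ - P.dfx t₂ x₂ u₂‖ ≤ L * (|t₁ - t₂| + ‖x₁ - x₂‖ + ‖u₁ - u₂‖)) ∧
    (∀ t₁ ∈ Icc 0 P.T, ∀ t₂ ∈ Icc 0 P.T, ∀ x₁ x₂, ∀ u₁ ∈ P.U, ∀ u₂ ∈ P.U,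
      ‖P.dfu t₁ x₁ u₁ - P.dfu t₂ x₂ u₂‖ ≤ L * (|t₁ - t₂| + ‖x₁ - x₂‖ + ‖u₁ - u₂‖))

/-- A pair of a state trajectory and a process of probability measures on the input space. Only
the values at times in `[0,T]` matter. -/
abbrev Pair (n m : ℕ) : Type :=
  (ℝ → EuclideanSpace ℝ (Fin n)) × (ℝ → ProbabilityMeasure (EuclideanSpace ℝ (Fin m)))

/-- The pair `(x, μ)` is feasible for the relaxed problem: `μ` is (Lebesgue) measurable in time and
a.e. supported in `U`, and `x` is the Carathéodory solution of
`x(0) = ξ`, `ẋ(t) = ∫ f(t, x(t), u) dμ_t(u)`, written as an integral equation. -/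
structure IsFeasible (P : ControlProblem n m) (z : Pair n m) : Prop where
  measurable : AEMeasurable (fun t => (z.2 t : Measure (EuclideanSpace ℝ (Fin m))))
    (volume.restrict (Icc 0 P.T))
  support : ∀ᵐ t ∂(volume.restrict (Icc 0 P.T)),
    (z.2 t : Measure (EuclideanSpace ℝ (Fin m))).support ⊆ P.U
  integrable : IntervalIntegrable
    (fun s => ∫ u, P.f s (z.1 s) u ∂(z.2 s : Measure (EuclideanSpace ℝ (Fin m)))) volume 0 P.T
  trajectory : ∀ t ∈ Icc 0 P.T, z.1 t = P.ξ +
    ∫ s in 0..t, ∫ u, P.f s (z.1 s) u ∂(z.2 s : Measure (EuclideanSpace ℝ (Fin m)))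

/-- The feasible set of the relaxed problem. -/
def feasibleSet (P : ControlProblem n m) : Set (Pair n m) := {z | P.IsFeasible z}

/-- The objective `Ψ(x(T))` of the relaxed problem. -/
def cost (P : ControlProblem n m) (z : Pair n m) : ℝ := P.Ψ (z.1 P.T)

/-- `δμ : [0,T] → signed measures` is an admissible variation of the process `μ₀`: it is measurable
in time and, for a.e. `t`, `supp (δμ_t + μ₀_t) ⊆ U`, `δμ_t + μ₀_t ≥ 0` and `∫ dδμ_t = 0`. -/
structure IsAdmissibleVariation (P : ControlProblem n m)
    (μ₀ : ℝ → ProbabilityMeasure (EuclideanSpace ℝ (Fin m)))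
    (δμ : ℝ → SignedMeasure (EuclideanSpace ℝ (Fin m))) : Prop where
  measurable : ∀ s : Set (EuclideanSpace ℝ (Fin m)), MeasurableSet s →
    AEMeasurable (fun t => δμ t s) (volume.restrict (Icc 0 P.T))
  support : ∀ᵐ t ∂(volume.restrict (Icc 0 P.T)),
    (δμ t + (μ₀ t : Measure (EuclideanSpace ℝ (Fin m))).toSignedMeasure).variation.support ⊆ P.U
  nonneg : ∀ᵐ t ∂(volume.restrict (Icc 0 P.T)),
    0 ≤ δμ t + (μ₀ t : Measure (EuclideanSpace ℝ (Fin m))).toSignedMeasure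
  mass : ∀ᵐ t ∂(volume.restrict (Icc 0 P.T)), δμ t univ = 0

/-- The right-hand side of the equation of `δx`, linearized along `(x, μ₀)`, at time `s`:
`∫ ∂f/∂x(s, x(s), u) dμ₀_s(u) δx(s) + ∫ f(s, x(s), u) dδμ_s(u)`. -/
noncomputable def linearizedField (P : ControlProblem n m) (z : Pair n m)
    (δμ : ℝ → SignedMeasure (EuclideanSpace ℝ (Fin m))) (δx : ℝ → EuclideanSpace ℝ (Fin n))
    (s : ℝ) : EuclideanSpace ℝ (Fin n) :=
  (∫ u, P.dfx s (z.1 s) u ∂(z.2 s : Measure (EuclideanSpace ℝ (Fin m)))) (δx s)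
    + ∫ᵛ u, P.f s (z.1 s) u ∂<•(δμ s)

/-- `δx` is the Carathéodory solution, with `δx(0) = 0`, of the linearized equation. -/
structure IsLinearizedTrajectory (P : ControlProblem n m) (z : Pair n m)
    (δμ : ℝ → SignedMeasure (EuclideanSpace ℝ (Fin m)))
    (δx : ℝ → EuclideanSpace ℝ (Fin n)) : Prop where
  integrable : IntervalIntegrable (P.linearizedField z δμ δx) volume 0 P.T
  trajectory : ∀ t ∈ Icc 0 P.T, δx t = ∫ s in 0..t, P.linearizedField z δμ δx s

/-- The objective values `∂Ψ/∂x(x(T))ᵀ δx(T)` of the feasible points of the problem that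
defines `θ_l`. -/
def valuesL (P : ControlProblem n m) (z : Pair n m) : Set ℝ :=
  {v | ∃ (δx : ℝ → EuclideanSpace ℝ (Fin n)) (δμ : ℝ → SignedMeasure (EuclideanSpace ℝ (Fin m))),
    P.IsAdmissibleVariation z.2 δμ ∧ P.IsLinearizedTrajectory z δμ δx ∧
    v = fderiv ℝ P.Ψ (z.1 P.T) (δx P.T)}

/-- The function `θ_l`. -/
noncomputable def thetaL (P : ControlProblem n m) (z : Pair n m) : ℝ := sInf (P.valuesL z)

/-- The Hamiltonian `H(t, x, ν, p) = pᵀ ∫ f(t, x, u) dν(u)`, for a signed measure `ν`. -/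
noncomputable def hamiltonian (P : ControlProblem n m) (t : ℝ) (x : EuclideanSpace ℝ (Fin n))
    (ν : SignedMeasure (EuclideanSpace ℝ (Fin m))) (p : EuclideanSpace ℝ (Fin n)) : ℝ :=
  inner ℝ p (∫ᵛ u, P.f t x u ∂<•ν)

/-- The vector `∫ ∂f/∂x(s, x(s), u)ᵀ dμ_s(u) p(s)`. -/
noncomputable def adjointField (P : ControlProblem n m) (z : Pair n m)
    (p : ℝ → EuclideanSpace ℝ (Fin n)) (s : ℝ) : EuclideanSpace ℝ (Fin n) :=
  (∫ u, ContinuousLinearMap.adjoint (P.dfx s (z.1 s) u)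
    ∂(z.2 s : Measure (EuclideanSpace ℝ (Fin m)))) (p s)

/-- `p` is a costate of `(x, μ)`: the Carathéodory solution on `[0,T]` of
`p(T) = ∂Ψ/∂x(x(T))`, `ṗ(t) = - ∫ ∂f/∂x(t, x(t), u)ᵀ dμ_t(u) p(t)`. -/
structure IsCostate (P : ControlProblem n m) (z : Pair n m)
    (p : ℝ → EuclideanSpace ℝ (Fin n)) : Prop where
  integrable : IntervalIntegrable (P.adjointField z p) volume 0 P.T
  costate : ∀ t ∈ Icc 0 P.T,
    p t = gradient P.Ψ (z.1 P.T) + ∫ s in t..P.T, P.adjointField z p s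

open Classical in
/-- The costate of `(x, μ)` (and `0` if there were none). -/
noncomputable def costate (P : ControlProblem n m) (z : Pair n m) :
    ℝ → EuclideanSpace ℝ (Fin n) :=
  if h : ∃ p, P.IsCostate z p then h.choose else 0

/-- The objective values `∫₀ᵀ H(t, x(t), δμ_t, p(t)) dt` of the feasible points of the problem that
defines `θ_h`. -/
noncomputable def valuesH (P : ControlProblem n m) (z : Pair n m) : Set ℝ :=
  {v | ∃ δμ : ℝ → SignedMeasure (EuclideanSpace ℝ (Fin m)), P.IsAdmissibleVariation z.2 δμ ∧
    v = ∫ t in 0..P.T, P.hamiltonian t (z.1 t) (δμ t) (P.costate z t)}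

/-- The function `θ_h`. -/
noncomputable def thetaH (P : ControlProblem n m) (z : Pair n m) : ℝ := sInf (P.valuesH z)

end ControlProblem

/-- `θ` is an optimality function of the problem of minimizing `J` over `S`: it is nonpositive
on `S` and vanishes at each minimizer. -/
def IsOptimalityFunction {X : Type*} (S : Set X) (J : X → ℝ) (θ : X → ℝ) : Prop :=
  (∀ z ∈ S, θ z ≤ 0) ∧ ∀ z ∈ S, IsMinOn J S z → θ z = 0

/-! If `δμ` is admissible, then for a.e. time `δμ_t + μ_t` is nonnegative with total mass one.
Admissible variations are therefore exactly the differences `ν - μ` with `ν` another relaxed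
control, up to a null set of times (`IsAdmissibleVariation.exists_isControl`,
`IsControl.isAdmissibleVariation`). This replaces signed measures by probability measures
throughout.

The two functions coincide on the feasible set. Integrating `pᵀ δx` by parts
(`inner_integral_eq_integral_inner_sub`) cancels the `∂f/∂x` terms and leaves `∫ pᵀ ∫ f dδμ dt`.
Since every admissible `δμ` has a linearized trajectory, the two sets of objective values are equal
(`valuesL_eq_valuesH`).

The common problem is to minimize, over controls `ν`, the integral of `pᵀ f(t, x(t), u)` against
`ν_t - μ_t`. It decouples in time: a measurable choice of pointwise minimizers `s(t)`
(`exists_measurable_argmin`) gives the optimal control `δ_{s(t)}`, so the minimum is attained.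
Taking `ν = μ` gives the value `0`, hence nonpositivity.

At a minimizer of the relaxed problem, perturb the control to `(1 - ε) μ + ε ν`. Grönwall puts the
new trajectory within `O(ε)` of the old one, and the same duality, applied to the true difference of
trajectories instead of a linearized one, shows that the cost changes by at most `ε v + O(ε²)`,
where `v` is the value of `ν - μ` (`exists_cost_le`). Letting `ε` tend to `0` forces `v ≥ 0`. -/

/-- Grönwall's inequality in integral form. -/
theorem le_mul_exp_of_le_add_integral {T c K : ℝ} (hT : 0 ≤ T) {u : ℝ → ℝ}
    (hu : ContinuousOn u (Icc 0 T)) (hu0 : ∀ t ∈ Icc 0 T, 0 ≤ u t) (hK : 0 ≤ K)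
    (h : ∀ t ∈ Icc 0 T, u t ≤ c + K * ∫ s in 0..t, u s) :
    ∀ t ∈ Icc 0 T, u t ≤ c * Real.exp (K * t) := by
  -- The constant extension beyond the endpoints is continuous on the whole line, so its primitive
  -- is differentiable everywhere.
  set w : ℝ → ℝ := IccExtend hT ((Icc 0 T).domRestrict u) with hw
  have hwc : Continuous w := (continuousOn_iff_continuous_domRestrict.1 hu).Icc_extend'
  have hwu : ∀ t ∈ Icc 0 T, w t = u t := fun t ht => IccExtend_of_mem hT _ ht
  have hw0 : ∀ t, 0 ≤ w t := fun t => hu0 _ (projIcc 0 T hT t).2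
  have hint : ∀ t ∈ Icc 0 T, ∫ s in 0..t, u s = ∫ s in 0..t, w s := fun t ht =>
    intervalIntegral.integral_congr fun s hs => by
      rw [uIcc_of_le ht.1] at hs
      exact (hwu s ⟨hs.1, hs.2.trans ht.2⟩).symm
  have hV : ∀ t, HasDerivAt (fun t => ∫ s in 0..t, w s) (w t) t := fun t =>
    (hwc.integral_hasStrictDerivAt 0 t).hasDerivAt
  have hV0 : ∀ t, 0 ≤ t → 0 ≤ ∫ s in 0..t, w s := fun t ht =>
    intervalIntegral.integral_nonneg ht fun s _ => hw0 s
  -- The differential Grönwall inequality is applied to the primitive `V` of `u`, for which the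
  -- hypothesis reads `V' ≤ c + K V` with `V(0) = 0`.
  have hG := norm_le_gronwallBound_of_norm_deriv_right_le (f := fun t => ∫ s in 0..t, w s)
    (f' := w) (δ := 0) (K := K) (ε := c) (a := 0) (b := T)
    (fun t _ => (hV t).continuousAt.continuousWithinAt)
    (fun t _ => (hV t).hasDerivWithinAt) (by simp) (fun t ht => by
      rw [Real.norm_of_nonneg (hw0 t), Real.norm_of_nonneg (hV0 t ht.1),
        hwu t (Ico_subset_Icc_self ht), ← hint t (Ico_subset_Icc_self ht)]
      linarith [h t (Ico_subset_Icc_self ht)])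
  intro t ht
  have h1 := h t ht
  have h2 := hG t ht
  rw [Real.norm_of_nonneg (hV0 t ht.1), ← hint t ht, sub_zero] at h2
  have h3 : c + K * gronwallBound 0 K c t = c * Real.exp (K * t) := by
    by_cases hK0 : K = 0
    · simp [hK0]
    · rw [gronwallBound_of_K_ne_0 hK0]
      field_simp
      ring
  rw [← h3]
  exact h1.trans (by gcongr)

/-! ### Carathéodory equations: existence by contraction -/

section Existence

variable {E : Type*} [NormedAddCommGroup E] [NormedSpace ℝ E] [CompleteSpace E]

/-- A Carathéodory initial value problem with a globally Lipschitz right-hand side has a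
solution. -/
theorem exists_integral_solution {T K : ℝ} (hT : 0 ≤ T) (hK : 0 < K) {F : ℝ → E → E}
    (hF : ∀ x : ℝ → E, Continuous x → IntervalIntegrable (fun s => F s (x s)) volume 0 T)
    (hL : ∀ᵐ s ∂(volume.restrict (Icc 0 T)), ∀ x y, ‖F s x - F s y‖ ≤ K * ‖x - y‖) (x₀ : E) :
    ∃ x : ℝ → E, Continuous x ∧ ∀ t ∈ Icc 0 T, x t = x₀ + ∫ s in 0..t, F s (x s) := by
  have hne : Nonempty C(Icc (0 : ℝ) T, E) := ⟨ContinuousMap.const _ 0⟩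
  -- Writing `x(s) = exp(2Ks) y(s)` makes the sup norm of `y` a weighted norm of `x`. In it the
  -- Picard operator contracts by `1/2` whatever the length of `[0,T]`, since `∫₀ᵗ K exp(2Ks) ds ≤
  -- exp(2Kt)/2`.
  set X : C(Icc (0 : ℝ) T, E) → ℝ → E := fun y s => Real.exp (2 * K * s) • IccExtend hT y s
    with hX
  have hXc : ∀ y, Continuous (X y) := fun y => by
    have : Continuous (IccExtend hT y) := y.continuous.Icc_extend'
    fun_prop
  have hi : ∀ y, ∀ t ∈ Icc 0 T, IntervalIntegrable (fun s => F s (X y s)) volume 0 t :=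
    fun y t ht => (hF _ (hXc y)).mono_set (by
      rw [uIcc_of_le ht.1, uIcc_of_le hT]; exact Icc_subset_Icc le_rfl ht.2)
  have hcont : ∀ y, ContinuousOn (fun t => ∫ s in 0..t, F s (X y s)) (Icc 0 T) := fun y => by
    have := intervalIntegral.continuousOn_primitive_interval' (hF _ (hXc y)) left_mem_uIcc
    rwa [uIcc_of_le hT] at this
  let Φ : C(Icc (0 : ℝ) T, E) → C(Icc (0 : ℝ) T, E) := fun y =>
    { toFun := fun t => Real.exp (-(2 * K * t)) • (x₀ + ∫ s in 0..(t : ℝ), F s (X y s))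
      continuous_toFun := by
        have := continuousOn_iff_continuous_domRestrict.1 (hcont y)
        have h2 : Continuous fun t : Icc (0 : ℝ) T => ∫ s in 0..(t : ℝ), F s (X y s) := this
        fun_prop }
  have hΦ : ContractingWith (1 / 2) Φ := by
    refine ⟨by norm_num, LipschitzWith.of_dist_le_mul fun y z => ?_⟩
    rw [ContinuousMap.dist_le (by positivity)]
    intro t
    have hd : ‖∫ s in 0..(t : ℝ), (F s (X y s) - F s (X z s))‖ ≤
        ∫ s in 0..(t : ℝ), K * (Real.exp (2 * K * s) * dist y z) := by
      refine intervalIntegral.norm_integral_le_of_norm_le t.2.1 ?_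
        (Continuous.intervalIntegrable (by fun_prop) _ _)
      have hL' := (ae_restrict_iff' measurableSet_Icc).1 hL
      filter_upwards [hL'] with s hs hst
      have hsT : s ∈ Icc 0 T := ⟨hst.1.le, hst.2.trans t.2.2⟩
      refine (hs hsT _ _).trans ?_
      gcongr
      rw [hX]
      simp only [← smul_sub, norm_smul, Real.norm_eq_abs, Real.abs_exp]
      gcongr
      rw [← dist_eq_norm]
      exact ContinuousMap.dist_apply_le_dist _
    have he : ∫ s in 0..(t : ℝ), K * (Real.exp (2 * K * s) * dist y z) =
        (Real.exp (2 * K * t) - 1) / 2 * dist y z := by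
      have hder : ∀ s ∈ uIcc 0 (t : ℝ), HasDerivAt (fun s => Real.exp (2 * K * s) / 2 * dist y z)
          (K * (Real.exp (2 * K * s) * dist y z)) s := fun s _ => by
        have := ((((hasDerivAt_id s).const_mul (2 * K)).exp).div_const 2).mul_const (dist y z)
        convert! this using 1
        simp only [id]
        ring
      rw [intervalIntegral.integral_eq_sub_of_hasDerivAt hder
        (Continuous.intervalIntegrable (by fun_prop) _ _)]
      simp
      ring
    change dist (Real.exp (-(2 * K * t)) • (x₀ + ∫ s in 0..(t : ℝ), F s (X y s)))
      (Real.exp (-(2 * K * t)) • (x₀ + ∫ s in 0..(t : ℝ), F s (X z s))) ≤ _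
    rw [dist_eq_norm, ← smul_sub, add_sub_add_left_eq_sub,
      ← intervalIntegral.integral_sub (hi y t t.2) (hi z t t.2), norm_smul, Real.norm_eq_abs,
      Real.abs_exp]
    calc Real.exp (-(2 * K * t)) * ‖∫ s in 0..(t : ℝ), (F s (X y s) - F s (X z s))‖
        ≤ Real.exp (-(2 * K * t)) * ((Real.exp (2 * K * t) - 1) / 2 * dist y z) := by
          gcongr; exact hd.trans he.le
      _ = (1 - Real.exp (-(2 * K * t))) / 2 * dist y z := by
          rw [Real.exp_neg]; field_simp
      _ ≤ _ := by
          have := Real.exp_pos (-(2 * K * t))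
          have hdz : 0 ≤ dist y z := dist_nonneg
          push_cast
          gcongr
          linarith
  obtain ⟨y, hy⟩ : ∃ y, Φ y = y := ⟨_, hΦ.fixedPoint_isFixedPt⟩
  refine ⟨X y, hXc y, fun t ht => ?_⟩
  have h1 : y ⟨t, ht⟩ = Real.exp (-(2 * K * t)) • (x₀ + ∫ s in 0..t, F s (X y s)) := by
    conv_lhs => rw [← hy]
    rfl
  change Real.exp (2 * K * t) • IccExtend hT y t = _
  rw [IccExtend_of_mem hT _ ht, h1, smul_smul, ← Real.exp_add]
  simp

/-- The terminal value version of `exists_integral_solution`. -/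
theorem exists_integral_solution_backward {T K : ℝ} (hT : 0 ≤ T) (hK : 0 < K) {F : ℝ → E → E}
    (hF : ∀ x : ℝ → E, Continuous x → IntervalIntegrable (fun s => F s (x s)) volume 0 T)
    (hL : ∀ᵐ s ∂(volume.restrict (Icc 0 T)), ∀ x y, ‖F s x - F s y‖ ≤ K * ‖x - y‖) (x₀ : E) :
    ∃ x : ℝ → E, Continuous x ∧ ∀ t ∈ Icc 0 T, x t = x₀ + ∫ s in t..T, F s (x s) := by
  obtain ⟨y, hyc, hy⟩ := exists_integral_solution (F := fun s x => F (T - s) x) hT hK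
    (fun x hx => by
      have := ((hF (fun s => x (T - s)) (by fun_prop)).comp_sub_left T).symm
      simpa using this)
    (by
      -- Time reversal preserves the measure on `[0,T]`, so the a.e. Lipschitz bound survives it.
      have hmp : MeasurePreserving (fun s : ℝ => T - s) (volume.restrict (Icc 0 T))
          (volume.restrict (Icc 0 T)) := by
        have := (Measure.measurePreserving_sub_left (volume : Measure ℝ) T).restrict_preimage
          (measurableSet_Icc (a := 0) (b := T))
        simpa using this
      exact hmp.quasiMeasurePreserving.ae hL) x₀
  refine ⟨fun s => y (T - s), by fun_prop, fun t ht => ?_⟩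
  beta_reduce
  rw [hy (T - t) ⟨by linarith [ht.2], by linarith [ht.1]⟩]
  have := intervalIntegral.integral_comp_sub_left (fun s => F s (y (T - s))) T (a := 0) (b := T - t)
  simp only [sub_sub_cancel, sub_zero] at this
  rw [this]

end Existence

/-! ### Integration by parts and Taylor remainder -/

section Duality

variable {E : Type*} [NormedAddCommGroup E] [InnerProductSpace ℝ E] [CompleteSpace E]

/-- Integration by parts for the inner product of two absolutely continuous curves. -/
theorem inner_integral_eq_integral_inner_sub {T : ℝ} (hT : 0 ≤ T) {g q e p : ℝ → E} {p₁ : E}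
    (hg : IntervalIntegrable g volume 0 T) (hq : IntervalIntegrable q volume 0 T)
    (he : ∀ t ∈ Icc 0 T, e t = ∫ s in 0..t, g s)
    (hp : ∀ t ∈ Icc 0 T, p t = p₁ + ∫ s in t..T, q s) :
    IntervalIntegrable (fun t => inner ℝ (p t) (g t) - inner ℝ (q t) (e t)) volume 0 T ∧
      inner ℝ p₁ (e T) = ∫ t in 0..T, (inner ℝ (p t) (g t) - inner ℝ (q t) (e t)) := by
  have hgi := (intervalIntegrable_iff_integrableOn_Ioc_of_le hT).1 hg
  have hqi := (intervalIntegrable_iff_integrableOn_Ioc_of_le hT).1 hq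
  set ν : Measure ℝ := volume.restrict (Ioc 0 T) with hν
  -- The identity is Fubini for `⟨q(r), g(s)⟩` on the triangle `s ≤ r`: integrating out `r` produces
  -- `p(s) - p₁`, and integrating out `s` produces `e(r)`. No differentiation of `p` or `e` is
  -- needed.
  set H : ℝ → ℝ → ℝ := fun s r => {z : ℝ × ℝ | z.1 ≤ z.2}.indicator
    (fun z => inner ℝ (q z.2) (g z.1)) (s, r) with hH
  have hHi : Integrable (Function.uncurry H) (ν.prod ν) := by
    have h1 : Integrable (fun z : ℝ × ℝ => inner ℝ (q z.2) (g z.1)) (ν.prod ν) :=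
      hgi.op_fst_snd (op := fun x y => inner ℝ y x) (by fun_prop)
        ⟨1, fun x y => by rw [one_mul, mul_comm]; exact norm_inner_le_norm y x⟩ hqi
    exact h1.indicator (measurableSet_le measurable_fst measurable_snd)
  have hswap := integral_integral_swap hHi
  have hleft : ∀ s ∈ Ioc 0 T, ∫ r, H s r ∂ν = inner ℝ (p s - p₁) (g s) := fun s hs => by
    rw [hp s ⟨hs.1.le, hs.2⟩, add_sub_cancel_left, real_inner_comm,
      intervalIntegral.integral_of_le hs.2]
    have : ∀ r, H s r = (Ici s).indicator (fun r => inner ℝ (g s) (q r)) r := fun r => by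
      simp only [hH, indicator, mem_ofPred_eq, mem_Ici, real_inner_comm]
    simp_rw [this]
    rw [integral_indicator measurableSet_Ici, hν, Measure.restrict_restrict measurableSet_Ici,
      ← integral_inner]
    · refine setIntegral_congr_set ?_
      have : Ici s ∩ Ioc 0 T = Icc s T := by
        ext r; constructor
        · rintro ⟨h1, h2, h3⟩; exact ⟨h1, h3⟩
        · rintro ⟨h1, h3⟩; exact ⟨h1, hs.1.trans_le h1, h3⟩
      rw [this]
      exact Ioc_ae_eq_Icc.symm
    · exact hqi.mono_set (Ioc_subset_Ioc_left hs.1.le)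
  have hright : ∀ r ∈ Ioc 0 T, ∫ s, H s r ∂ν = inner ℝ (q r) (e r) := fun r hr => by
    rw [he r ⟨hr.1.le, hr.2⟩, intervalIntegral.integral_of_le hr.1.le]
    have : ∀ s, H s r = (Iic r).indicator (fun s => inner ℝ (q r) (g s)) s := fun s => by
      simp only [hH, indicator, mem_ofPred_eq, mem_Iic]
    simp_rw [this]
    rw [integral_indicator measurableSet_Iic, hν, Measure.restrict_restrict measurableSet_Iic,
      ← integral_inner]
    · have : Iic r ∩ Ioc 0 T = Ioc 0 r := by
        ext s; constructor
        · rintro ⟨h1, h2, h3⟩; exact ⟨h2, h1⟩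
        · rintro ⟨h1, h3⟩; exact ⟨h3, h1, h3.trans hr.2⟩
      rw [this]
    · exact hgi.mono_set (Ioc_subset_Ioc_right hr.2)
  have hl : ∫ s, inner ℝ (p s - p₁) (g s) ∂ν = ∫ r, inner ℝ (q r) (e r) ∂ν := by
    calc _ = ∫ s, (∫ r, H s r ∂ν) ∂ν :=
          setIntegral_congr_fun measurableSet_Ioc fun s hs => (hleft s hs).symm
      _ = _ := hswap
      _ = _ := setIntegral_congr_fun measurableSet_Ioc hright
  have hli : Integrable (fun s => inner ℝ (p s - p₁) (g s)) ν :=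
    hHi.integral_prod_left.congr ((ae_restrict_iff' measurableSet_Ioc).2 (ae_of_all _ hleft))
  have hri : Integrable (fun s => inner ℝ (q s) (e s)) ν :=
    hHi.integral_prod_right.congr ((ae_restrict_iff' measurableSet_Ioc).2 (ae_of_all _ hright))
  have hpi : Integrable (fun s => inner ℝ p₁ (g s)) ν := hgi.const_inner p₁
  have h3 : ∀ s, inner ℝ (p s) (g s) = inner ℝ (p s - p₁) (g s) + inner ℝ p₁ (g s) := fun s => by
    rw [← inner_add_left, sub_add_cancel]
  simp_rw [h3]
  refine ⟨(intervalIntegrable_iff_integrableOn_Ioc_of_le hT).2 ((hli.add hpi).sub hri), ?_⟩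
  rw [intervalIntegral.integral_of_le hT, he T ⟨hT, le_rfl⟩, intervalIntegral.integral_of_le hT,
    ← integral_inner hgi]
  have h4 := integral_sub (hli.add hpi) hri
  have h5 := integral_add hli hpi
  simp only [Pi.add_apply] at h4
  rw [h4, h5, hl]
  ring

end Duality

/-- The quadratic remainder bound for a function with Lipschitz derivative. -/
theorem norm_sub_sub_fderiv_le_of_lipschitz {E F : Type*} [NormedAddCommGroup E] [NormedSpace ℝ E]
    [NormedAddCommGroup F] [NormedSpace ℝ F] {g : E → F} {L : ℝ} (hL : 0 ≤ L)
    (hg : ∀ x, DifferentiableAt ℝ g x)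
    (hl : ∀ x y, ‖fderiv ℝ g x - fderiv ℝ g y‖ ≤ L * ‖x - y‖) (x y : E) :
    ‖g y - g x - fderiv ℝ g x (y - x)‖ ≤ L * ‖y - x‖ ^ 2 := by
  have := (convex_closedBall x ‖y - x‖).norm_image_sub_le_of_norm_fderiv_le' (𝕜 := ℝ) (f := g)
    (φ := fderiv ℝ g x) (C := L * ‖y - x‖) (x := x) (y := y) (fun z _ => hg z)
    (fun z hz => (hl z x).trans (by
      gcongr; simpa [dist_eq_norm] using hz))
    (by simp) (by simp [dist_eq_norm])
  rw [pow_two, ← mul_assoc]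
  exact this

/-! ### Measurable selection of minimizers -/

section Selection

variable {Y : Type*} [MetricSpace Y] [MeasurableSpace Y] [BorelSpace Y]

/-- A continuous function on a product of an interval and a compact set has a measurable selection
of minimizers. -/
theorem exists_measurable_argmin {a b : ℝ} (hab : a ≤ b) {U : Set Y} (hU : IsCompact U)
    (hne : U.Nonempty) {h : ℝ → Y → ℝ} (hh : ContinuousOn (Function.uncurry h) (Icc a b ×ˢ U)) :
    ∃ s : ℝ → Y, Measurable s ∧ (∀ t, s t ∈ U) ∧ ∀ t ∈ Icc a b, ∀ u ∈ U, h t (s t) ≤ h t u := by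
  have : CompactSpace U := isCompact_iff_compactSpace.1 hU
  have : Nonempty U := hne.to_subtype
  have : CompactSpace cantorSet := isCompact_iff_compactSpace.1 isCompact_cantorSet
  have : Nonempty cantorSet := ⟨⟨0, zero_mem_cantorSet⟩⟩
  obtain ⟨g₀, hg₀, hg₀s⟩ := exists_nat_bool_continuous_surjective_of_compact U
  -- Parametrizing `U` by the Cantor set gives the minimizers a linear order, so that a canonical
  -- one, with the least parameter, can be chosen.
  obtain ⟨G, hG, hGs⟩ : ∃ G : cantorSet → U, Continuous G ∧ Function.Surjective G :=
    ⟨g₀ ∘ cantorSetHomeomorphNatToBool, hg₀.comp cantorSetHomeomorphNatToBool.continuous,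
      hg₀s.comp cantorSetHomeomorphNatToBool.surjective⟩
  set k : Icc a b × cantorSet → ℝ := fun z => h z.1 (G z.2) with hk
  have hkc : Continuous k :=
    hh.comp_continuous (f := fun z : Icc a b × cantorSet => ((z.1 : ℝ), (G z.2 : Y)))
      (by fun_prop) fun z => ⟨z.1.2, (G z.2).2⟩
  have hex : ∀ t : Icc a b, ∃ c, IsLeast {c | ∀ c', k (t, c) ≤ k (t, c')} c := fun t => by
    refine IsCompact.exists_isLeast (IsClosed.isCompact ?_) ?_
    · rw [ofPred_forall]
      exact isClosed_iInter fun c' => isClosed_le (by fun_prop) (by fun_prop)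
    · obtain ⟨c, -, hc⟩ := isCompact_univ.exists_isMinOn univ_nonempty
        (f := fun c => k (t, c)) (by fun_prop)
      exact ⟨c, fun c' => hc (mem_univ c')⟩
  choose σ hσ using hex
  have hσm : Measurable σ := by
    refine Measurable.subtype_mk (f := fun t => (σ t : ℝ)) (measurable_of_Iic fun α => ?_)
    -- The least parameter is at most `α` exactly when some minimizing parameter is. Hence `{σ ≤ α}`
    -- is the projection of a compact set, and therefore closed.
    have hcl : IsClosed {z : Icc a b × cantorSet | (z.2 : ℝ) ≤ α ∧ ∀ c', k z ≤ k (z.1, c')} := by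
      rw [ofPred_and, ofPred_forall]
      exact (isClosed_le (by fun_prop) (by fun_prop)).inter
        (isClosed_iInter fun c' => isClosed_le (by fun_prop) (by fun_prop))
    have : (fun t => (σ t : ℝ)) ⁻¹' Iic α =
        Prod.fst '' {z : Icc a b × cantorSet | (z.2 : ℝ) ≤ α ∧ ∀ c', k z ≤ k (z.1, c')} := by
      ext t
      constructor
      · intro ht
        exact ⟨(t, σ t), ⟨ht, (hσ t).1⟩, rfl⟩
      · rintro ⟨⟨t, c⟩, ⟨hc, hc'⟩, rfl⟩
        exact le_trans (Subtype.coe_le_coe.2 ((hσ t).2 hc')) hc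
    rw [this]
    exact (hcl.isCompact.image continuous_fst).isClosed.measurableSet
  refine ⟨fun t => G (σ (projIcc a b hab t)), ?_, fun t => (G _).2, fun t ht u hu => ?_⟩
  · exact measurable_subtype_coe.comp (hG.measurable.comp
      (hσm.comp (continuous_projIcc (h := hab)).measurable))
  · obtain ⟨c, hc⟩ := hGs ⟨u, hu⟩
    have := (hσ (projIcc a b hab t)).1 c
    beta_reduce
    rw [projIcc_of_mem hab ht] at this ⊢
    simpa [hk, hc] using this

end Selection

/-! ### Measurable families of probability measures -/

section MeasurableFamilies

variable {α Y : Type*} [MeasurableSpace α] {μ : Measure α} [MeasurableSpace Y]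

/-- An a.e. measurable family of probability measures agrees a.e. with a measurable one. -/
theorem exists_measurable_probabilityMeasure [Nonempty Y] {ν : α → Measure Y}
    (hν : AEMeasurable ν μ) (hp : ∀ᵐ t ∂μ, IsProbabilityMeasure (ν t)) :
    ∃ κ : α → Measure Y, Measurable κ ∧ (∀ t, IsProbabilityMeasure (κ t)) ∧ ν =ᵐ[μ] κ := by
  obtain ⟨κ, hκ, hr, he⟩ := hν.exists_ae_eq_range_subset (t := {ρ | IsProbabilityMeasure ρ}) hp
    ⟨Measure.dirac (Classical.arbitrary Y), by simp only [mem_ofPred_eq]; infer_instance⟩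
  exact ⟨κ, hκ, fun t => hr ⟨t, rfl⟩, he⟩

/-- A family of probability measures that is a.e. measurable on each set is a.e. measurable. -/
theorem aemeasurable_measure_of_forall_measurableSet [MeasurableSpace.CountablyGenerated Y]
    [Nonempty Y] {ν : α → Measure Y} (hp : ∀ᵐ t ∂μ, IsProbabilityMeasure (ν t))
    (hν : ∀ s, MeasurableSet s → AEMeasurable (fun t => ν t s) μ) : AEMeasurable ν μ := by
  classical
  -- A countable generating algebra allows the exceptional null sets, one for each member, to be
  -- merged into a single `N`; being a π-system, it determines probability measures.
  set C := generateSetAlgebra (MeasurableSpace.countableGeneratingSet Y) with hC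
  have hCc : C.Countable := countable_generateSetAlgebra
    (MeasurableSpace.countable_countableGeneratingSet (α := Y))
  have hgen : ‹MeasurableSpace Y› = .generateFrom C := by
    rw [hC, generateFrom_generateSetAlgebra_eq, MeasurableSpace.generateFrom_countableGeneratingSet]
  have hCm : ∀ s ∈ C, MeasurableSet s := fun s hs => by
    rw [hgen]; exact MeasurableSpace.measurableSet_generateFrom hs
  have hall : ∀ᵐ t ∂μ, IsProbabilityMeasure (ν t) ∧
      ∀ s (hs : s ∈ C), ν t s = (hν s (hCm s hs)).mk _ t :=
    hp.and ((ae_ball_iff hCc).2 fun s hs => (hν s (hCm s hs)).ae_eq_mk)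
  obtain ⟨N, hNs, hNm, hN⟩ := exists_measurable_superset_of_null (ae_iff.1 hall)
  have hgood : ∀ t ∉ N, IsProbabilityMeasure (ν t) ∧
      ∀ s (hs : s ∈ C), ν t s = (hν s (hCm s hs)).mk _ t := fun t ht => by
    by_contra hc
    exact ht (hNs hc)
  set y₀ := Classical.arbitrary Y
  -- The Dirac value on `N` keeps every `κ t` a probability measure, as the π-system criterion
  -- requires.
  set κ : α → Measure Y := N.piecewise (fun _ => Measure.dirac y₀) ν with hκ
  have hκp : ∀ t, IsProbabilityMeasure (κ t) := fun t => by
    by_cases ht : t ∈ N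
    · rw [hκ, piecewise_eq_of_mem _ _ _ ht]; infer_instance
    · rw [hκ, piecewise_eq_of_notMem _ _ _ ht]; exact (hgood t ht).1
  have hκm : Measurable κ := by
    refine Measurable.measure_of_isPiSystem_of_isProbabilityMeasure hgen
      (isSetAlgebra_generateSetAlgebra.isSetRing.isSetSemiring.isPiSystem) fun s hs => ?_
    have : (fun t => κ t s) = N.piecewise (fun _ => Measure.dirac y₀ s)
        ((hν s (hCm s hs)).mk _) := by
      ext t
      by_cases ht : t ∈ N
      · simp [hκ, piecewise_eq_of_mem _ _ _ ht]
      · rw [hκ, piecewise_eq_of_notMem _ _ _ ht, piecewise_eq_of_notMem _ _ _ ht,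
          (hgood t ht).2 s hs]
    rw [this]
    exact measurable_const.piecewise hNm (hν s (hCm s hs)).measurable_mk
  refine ⟨κ, hκm, ?_⟩
  have : ∀ᵐ t ∂μ, t ∉ N := measure_eq_zero_iff_ae_notMem.1 hN
  filter_upwards [this] with t ht
  rw [hκ, piecewise_eq_of_notMem _ _ _ ht]

/-- Integrating a function that is continuous on a product set against an a.e. measurable family
of probability measures gives an a.e. measurable function. -/
theorem aestronglyMeasurable_integral_of_continuousOn {F : Type*} [NormedAddCommGroup F]
    [NormedSpace ℝ F] [SecondCountableTopology F] [TopologicalSpace Y] [BorelSpace Y]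
    [SecondCountableTopology Y] [Nonempty Y] [TopologicalSpace α] [BorelSpace α]
    [SecondCountableTopology α] {K : Set α} (hK : MeasurableSet K)
    {U : Set Y} (hU : MeasurableSet U) {ν : α → Measure Y}
    (hν : AEMeasurable ν (μ.restrict K)) (hp : ∀ᵐ t ∂(μ.restrict K), IsProbabilityMeasure (ν t))
    (hs : ∀ᵐ t ∂(μ.restrict K), ν t Uᶜ = 0) {φ : α → Y → F}
    (hφ : ContinuousOn (Function.uncurry φ) (K ×ˢ U)) :
    AEStronglyMeasurable (fun t => ∫ u, φ t u ∂(ν t)) (μ.restrict K) := by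
  classical
  borelize F
  obtain ⟨κ, hκ, hκp, hνκ⟩ := exists_measurable_probabilityMeasure hν hp
  let k : ProbabilityTheory.Kernel α Y := ⟨κ, hκ⟩
  have : ProbabilityTheory.IsMarkovKernel k := ⟨hκp⟩
  -- Nothing is known about `φ` off `K ×ˢ U`; extension by zero gives joint measurability and leaves
  -- the integrals unchanged for a.e. `t`.
  set ψ : α × Y → F := (K ×ˢ U).piecewise (Function.uncurry φ) (fun _ => 0) with hψ
  have hψm : StronglyMeasurable ψ :=
    (hφ.measurable_piecewise continuousOn_const (hK.prod hU)).stronglyMeasurable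
  have hI : StronglyMeasurable fun t => ∫ u, ψ (t, u) ∂(k t) := hψm.integral_kernel_prod_right'
  refine hI.aestronglyMeasurable.congr ?_
  filter_upwards [hνκ, hs, ae_restrict_mem hK] with t ht hst htK
  have : k t = ν t := ht.symm
  rw [this]
  refine integral_congr_ae ?_
  have hmem : ∀ᵐ u ∂(ν t), u ∈ U := hst
  filter_upwards [hmem] with u hu
  rw [hψ, piecewise_eq_of_mem _ _ _ (mk_mem_prod htK hu)]
  rfl

/-- A function continuous on a compact set is integrable for the finite measures carried by it. -/
theorem integrable_of_continuousOn_of_measure_compl_eq_zero {F : Type*} [NormedAddCommGroup F]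
    [TopologicalSpace Y] [T2Space Y] [BorelSpace Y] [SecondCountableTopology Y]
    [TopologicalSpace.PseudoMetrizableSpace Y]
    {U : Set Y} (hU : IsCompact U) {ρ : Measure Y} [IsFiniteMeasure ρ] (hs : ρ Uᶜ = 0) {g : Y → F}
    (hg : ContinuousOn g U) : Integrable g ρ := by
  have h := hg.integrableOn_compact (μ := ρ) hU
  rwa [IntegrableOn, Measure.restrict_eq_self_of_ae_mem (s := U) hs] at h

end MeasurableFamilies

/-! ### Interval integrals and continuity -/

theorem IntervalIntegrable.mono_Icc {E : Type*} [NormedAddCommGroup E] {T : ℝ} {g : ℝ → E}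
    (hg : IntervalIntegrable g volume 0 T) {a b : ℝ}
    (ha : a ∈ Icc 0 T) (hb : b ∈ Icc 0 T) : IntervalIntegrable g volume a b :=
  hg.mono_set (by
    rw [uIcc_of_le (ha.1.trans ha.2)]
    exact uIcc_subset_Icc ha hb)

theorem IntervalIntegrable.congr_ae_Icc {E : Type*} [NormedAddCommGroup E] {T : ℝ} (hT : 0 ≤ T)
    {g h : ℝ → E}
    (hg : IntervalIntegrable g volume 0 T)
    (hgh : ∀ᵐ s ∂(volume.restrict (Icc 0 T)), g s = h s) : IntervalIntegrable h volume 0 T := by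
  rw [intervalIntegrable_iff_integrableOn_Icc_of_le hT] at hg ⊢
  exact Integrable.congr hg hgh

section IntervalHelpers

variable {E : Type*} [NormedAddCommGroup E] [NormedSpace ℝ E] {T : ℝ}

theorem intervalIntegral_congr_ae_Icc {g h : ℝ → E}
    (hgh : ∀ᵐ s ∂(volume.restrict (Icc 0 T)), g s = h s) {t : ℝ} (ht : t ∈ Icc 0 T) :
    ∫ s in 0..t, g s = ∫ s in 0..t, h s := by
  refine intervalIntegral.integral_congr_ae ?_
  filter_upwards [(ae_restrict_iff' measurableSet_Icc).1 hgh] with s hs hst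
  rw [uIoc_of_le ht.1] at hst
  exact hs ⟨hst.1.le, hst.2.trans ht.2⟩

theorem norm_intervalIntegral_le_of_ae_Icc {g : ℝ → E} {h : ℝ → ℝ}
    (hgh : ∀ᵐ s ∂(volume.restrict (Icc 0 T)), ‖g s‖ ≤ h s) {t : ℝ} (ht : t ∈ Icc 0 T)
    (hh : IntervalIntegrable h volume 0 t) : ‖∫ s in 0..t, g s‖ ≤ ∫ s in 0..t, h s := by
  refine intervalIntegral.norm_integral_le_of_norm_le ht.1 ?_ hh
  filter_upwards [(ae_restrict_iff' measurableSet_Icc).1 hgh] with s hs hst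
  exact hs ⟨hst.1.le, hst.2.trans ht.2⟩

theorem continuousOn_of_eq_add_integral [CompleteSpace E] {g x : ℝ → E} {x₀ : E} (hT : 0 ≤ T)
    (hg : IntervalIntegrable g volume 0 T) (hx : ∀ t ∈ Icc 0 T, x t = x₀ + ∫ s in 0..t, g s) :
    ContinuousOn x (Icc 0 T) := by
  have := intervalIntegral.continuousOn_primitive_interval' hg left_mem_uIcc
  rw [uIcc_of_le hT] at this
  exact (continuousOn_const.add this).congr hx

theorem continuousOn_of_eq_add_integral_left [CompleteSpace E] {g x : ℝ → E} {x₀ : E} (hT : 0 ≤ T)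
    (hg : IntervalIntegrable g volume 0 T) (hx : ∀ t ∈ Icc 0 T, x t = x₀ + ∫ s in t..T, g s) :
    ContinuousOn x (Icc 0 T) := by
  have := intervalIntegral.continuousOn_primitive_interval' hg right_mem_uIcc
  rw [uIcc_of_le hT] at this
  refine ((continuousOn_const (c := x₀)).sub this).congr fun t ht => ?_
  rw [hx t ht, intervalIntegral.integral_symm T t, ← sub_eq_add_neg]
  rfl

/-- A function with a joint Lipschitz bound is continuous in time and input along a continuous
state. -/
theorem continuousOn_uncurry_of_joint_lipschitz {X V F : Type*} [NormedAddCommGroup X]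
    [NormedAddCommGroup V] [NormedAddCommGroup F] {L : ℝ} {U : Set V} {G : ℝ → X → V → F}
    (hG : ∀ t₁ ∈ Icc 0 T, ∀ t₂ ∈ Icc 0 T, ∀ x₁ x₂, ∀ u₁ ∈ U, ∀ u₂ ∈ U,
      ‖G t₁ x₁ u₁ - G t₂ x₂ u₂‖ ≤ L * (|t₁ - t₂| + ‖x₁ - x₂‖ + ‖u₁ - u₂‖)) {x : ℝ → X}
    (hx : ContinuousOn x (Icc 0 T)) :
    ContinuousOn (Function.uncurry fun t u => G t (x t) u) (Icc 0 T ×ˢ U) := by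
  rintro ⟨t₀, u₀⟩ ⟨ht₀, hu₀⟩
  rw [ContinuousWithinAt, tendsto_iff_norm_sub_tendsto_zero]
  have hc : ContinuousOn (fun z : ℝ × V => L * (|z.1 - t₀| + ‖x z.1 - x t₀‖ + ‖z.2 - u₀‖))
      (Icc 0 T ×ˢ U) := by
    have : ContinuousOn (fun z : ℝ × V => x z.1) (Icc 0 T ×ˢ U) :=
      hx.comp continuousOn_fst fun z hz => hz.1
    have h2 : Continuous fun z : ℝ × V => |z.1 - t₀| := by fun_prop
    have h3 : Continuous fun z : ℝ × V => ‖z.2 - u₀‖ := by fun_prop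
    exact continuousOn_const.mul
      ((h2.continuousOn.add (this.sub continuousOn_const).norm).add h3.continuousOn)
  have h0 := hc (t₀, u₀) ⟨ht₀, hu₀⟩
  rw [ContinuousWithinAt] at h0
  simp only [sub_self, abs_zero, norm_zero, add_zero, mul_zero] at h0
  refine squeeze_zero' (Filter.Eventually.of_forall fun _ => norm_nonneg _) ?_ h0
  filter_upwards [self_mem_nhdsWithin] with z hz
  exact hG z.1 hz.1 t₀ ht₀ _ _ z.2 hz.2 u₀ hu₀

/-- Integration of operators and passing to the adjoint. -/
theorem inner_integral_adjoint_apply {E Ω : Type*} [NormedAddCommGroup E] [InnerProductSpace ℝ E]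
    [CompleteSpace E] [MeasurableSpace Ω] {ρ : Measure Ω} {A : Ω → E →L[ℝ] E}
    (hA : Integrable A ρ) (p e : E) :
    inner ℝ ((∫ u, ContinuousLinearMap.adjoint (A u) ∂ρ) p) e = inner ℝ p ((∫ u, A u ∂ρ) e) := by
  have hA' : Integrable (fun u => ContinuousLinearMap.adjoint (A u)) ρ :=
    hA.norm.mono' (ContinuousLinearMap.adjoint.continuous.comp_aestronglyMeasurable hA.1)
      (ae_of_all _ fun u => (LinearIsometryEquiv.norm_map _ _).le)
  rw [ContinuousLinearMap.integral_apply hA', ContinuousLinearMap.integral_apply hA,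
    real_inner_comm, ← integral_inner (hA'.apply_continuousLinearMap p),
    ← integral_inner (hA.apply_continuousLinearMap e)]
  refine integral_congr_ae (ae_of_all _ fun u => ?_)
  simp only
  rw [real_inner_comm, ContinuousLinearMap.adjoint_inner_left]

end IntervalHelpers

/-! ### Bounds on the data, relaxed controls and their trajectories -/

namespace ControlProblem

variable {n m : ℕ} {P : ControlProblem n m}

/-- The estimates used below, collected for one constant. -/
theorem LipschitzDifferentiable.exists_bounds (hP : P.LipschitzDifferentiable) :
    ∃ L : ℝ, 0 < L ∧
      (∀ x y, |P.Ψ y - P.Ψ x - fderiv ℝ P.Ψ x (y - x)| ≤ L * ‖y - x‖ ^ 2) ∧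
      (∀ t ∈ Icc 0 P.T, ∀ x y, ∀ u ∈ P.U, ‖P.f t x u - P.f t y u‖ ≤ L * ‖x - y‖) ∧
      (∀ t ∈ Icc 0 P.T, ∀ x, ∀ u ∈ P.U, ‖P.dfx t x u‖ ≤ L) ∧
      (∀ t ∈ Icc 0 P.T, ∀ x y, ∀ u ∈ P.U,
        ‖P.f t y u - P.f t x u - P.dfx t x u (y - x)‖ ≤ L * ‖y - x‖ ^ 2) ∧
      (∀ t ∈ Icc 0 P.T, ∀ x, ∀ u ∈ P.U, ∀ v ∈ P.U, ‖P.f t x u - P.f t x v‖ ≤ L * ‖u - v‖) := by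
  obtain ⟨L, hL, -, hΨ, hf, hfx, -⟩ := hP.lipschitz
  have hfl : ∀ t ∈ Icc 0 P.T, ∀ x y, ∀ u ∈ P.U, ‖P.f t x u - P.f t y u‖ ≤ L * ‖x - y‖ :=
    fun t ht x y u hu => by simpa using hf t ht t ht x y u hu u hu
  refine ⟨L, hL, fun x y => ?_, hfl, fun t ht x u hu => ?_, fun t ht x y u hu => ?_,
    fun t ht x u hu v hv => by simpa using hf t ht t ht x x u hu v hv⟩
  · exact norm_sub_sub_fderiv_le_of_lipschitz hL.le hP.diff_cost hΨ x y
  -- A Lipschitz constant of `f` in the state bounds `∂f/∂x` uniformly, although the state space is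
  -- not compact.
  · exact norm_fderiv_le_of_lip' ℝ hL.le (Filter.Eventually.of_forall fun y => hfl t ht y x u hu)
  · refine norm_sub_sub_fderiv_le_of_lipschitz hL.le (fun x => hP.diff_state t ht x u hu)
      (fun x y => ?_) x y
    simpa [dfx] using hfx t ht t ht x y u hu u hu

theorem LipschitzDifferentiable.continuousOn_f (hP : P.LipschitzDifferentiable)
    {x : ℝ → EuclideanSpace ℝ (Fin n)} (hx : ContinuousOn x (Icc 0 P.T)) :
    ContinuousOn (Function.uncurry fun t u => P.f t (x t) u) (Icc 0 P.T ×ˢ P.U) := by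
  obtain ⟨L, -, -, -, hf, -, -⟩ := hP.lipschitz
  exact continuousOn_uncurry_of_joint_lipschitz hf hx

theorem LipschitzDifferentiable.continuousOn_dfx (hP : P.LipschitzDifferentiable)
    {x : ℝ → EuclideanSpace ℝ (Fin n)} (hx : ContinuousOn x (Icc 0 P.T)) :
    ContinuousOn (Function.uncurry fun t u => P.dfx t (x t) u) (Icc 0 P.T ×ˢ P.U) := by
  obtain ⟨L, -, -, -, -, hf, -⟩ := hP.lipschitz
  exact continuousOn_uncurry_of_joint_lipschitz hf hx

/-- A measurable process of probability measures carried by the input set. -/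
structure IsControl (P : ControlProblem n m)
    (ν : ℝ → ProbabilityMeasure (EuclideanSpace ℝ (Fin m))) : Prop where
  measurable : AEMeasurable (fun t => (ν t : Measure (EuclideanSpace ℝ (Fin m))))
    (volume.restrict (Icc 0 P.T))
  compl : ∀ᵐ t ∂(volume.restrict (Icc 0 P.T)), (ν t : Measure (EuclideanSpace ℝ (Fin m))) P.Uᶜ = 0

theorem measure_compl_eq_zero_of_support_subset {Y : Type*} [TopologicalSpace Y]
    [SecondCountableTopology Y] [MeasurableSpace Y] {ρ : Measure Y} {U : Set Y}
    (h : ρ.support ⊆ U) : ρ Uᶜ = 0 :=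
  measure_mono_null (compl_subset_compl.2 h) Measure.measure_compl_support

theorem IsFeasible.isControl {z : Pair n m} (hz : P.IsFeasible z) : P.IsControl z.2 :=
  ⟨hz.measurable, hz.support.mono fun _ ht => measure_compl_eq_zero_of_support_subset ht⟩

theorem IsFeasible.continuousOn {z : Pair n m} (hz : P.IsFeasible z) (hT : 0 ≤ P.T) :
    ContinuousOn z.1 (Icc 0 P.T) :=
  continuousOn_of_eq_add_integral hT hz.integrable hz.trajectory

namespace IsControl

variable {ν : ℝ → ProbabilityMeasure (EuclideanSpace ℝ (Fin m))}
  {F : Type*} [NormedAddCommGroup F] {φ : ℝ → EuclideanSpace ℝ (Fin m) → F}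

theorem ae_integrable (hν : P.IsControl ν) (hU : IsCompact P.U)
    (hφ : ContinuousOn (Function.uncurry φ) (Icc 0 P.T ×ˢ P.U)) :
    ∀ᵐ t ∂(volume.restrict (Icc 0 P.T)),
      Integrable (φ t) (ν t : Measure (EuclideanSpace ℝ (Fin m))) := by
  filter_upwards [hν.compl, ae_restrict_mem measurableSet_Icc] with t ht htT
  refine integrable_of_continuousOn_of_measure_compl_eq_zero hU ht ?_
  exact hφ.comp (f := fun u => (t, u)) (by fun_prop) fun u hu => ⟨htT, hu⟩

variable [NormedSpace ℝ F]

theorem ae_norm_integral_le (hν : P.IsControl ν) {c : ℝ → ℝ}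
    (hc : ∀ t ∈ Icc 0 P.T, ∀ u ∈ P.U, ‖φ t u‖ ≤ c t) :
    ∀ᵐ t ∂(volume.restrict (Icc 0 P.T)),
      ‖∫ u, φ t u ∂(ν t : Measure (EuclideanSpace ℝ (Fin m)))‖ ≤ c t := by
  filter_upwards [hν.compl, ae_restrict_mem measurableSet_Icc] with t ht htT
  have hmem : ∀ᵐ u ∂(ν t : Measure (EuclideanSpace ℝ (Fin m))), u ∈ P.U := ht
  have := norm_integral_le_of_norm_le_const (hmem.mono fun u hu => hc t htT u hu)
  simpa using this

theorem intervalIntegrable_integral [SecondCountableTopology F] (hν : P.IsControl ν)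
    (hT : 0 ≤ P.T) (hU : IsCompact P.U)
    (hφ : ContinuousOn (Function.uncurry φ) (Icc 0 P.T ×ˢ P.U)) :
    IntervalIntegrable (fun t => ∫ u, φ t u ∂(ν t : Measure (EuclideanSpace ℝ (Fin m))))
      volume 0 P.T := by
  rw [intervalIntegrable_iff_integrableOn_Icc_of_le hT]
  obtain ⟨C, hC⟩ := (isCompact_Icc.prod hU).exists_bound_of_continuousOn hφ
  refine Integrable.of_bound (aestronglyMeasurable_integral_of_continuousOn measurableSet_Icc
    hU.measurableSet hν.measurable (ae_of_all _ fun _ => inferInstance) hν.compl hφ) C ?_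
  exact hν.ae_norm_integral_le fun t ht u hu => hC (t, u) ⟨ht, hu⟩

end IsControl

/-- Every control has a trajectory, and makes a feasible pair with it. -/
theorem IsControl.exists_isFeasible {ν : ℝ → ProbabilityMeasure (EuclideanSpace ℝ (Fin m))}
    (hν : P.IsControl ν) (hT : 0 ≤ P.T) (hU : IsCompact P.U) (hP : P.LipschitzDifferentiable) :
    ∃ x, P.IsFeasible (x, ν) := by
  obtain ⟨L, hL, -, hf, -⟩ := hP.exists_bounds
  have hi : ∀ x : ℝ → EuclideanSpace ℝ (Fin n), Continuous x → IntervalIntegrable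
      (fun s => ∫ u, P.f s (x s) u ∂(ν s : Measure (EuclideanSpace ℝ (Fin m)))) volume 0 P.T :=
    fun x hx => hν.intervalIntegrable_integral hT hU (hP.continuousOn_f hx.continuousOn)
  obtain ⟨x, hx, hxe⟩ := exists_integral_solution hT hL
    (F := fun s x => ∫ u, P.f s x u ∂(ν s : Measure (EuclideanSpace ℝ (Fin m)))) hi (by
      filter_upwards [hν.compl, ae_restrict_mem measurableSet_Icc] with t ht htT x y
      have hcont : ∀ x, Integrable (P.f t x) (ν t : Measure (EuclideanSpace ℝ (Fin m))) := fun x =>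
        integrable_of_continuousOn_of_measure_compl_eq_zero hU ht
          ((hP.continuousOn_f (x := fun _ => x) continuousOn_const).comp
            (f := fun u => (t, u)) (by fun_prop) fun u hu => ⟨htT, hu⟩)
      rw [← integral_sub (hcont x) (hcont y)]
      have hmem : ∀ᵐ u ∂(ν t : Measure (EuclideanSpace ℝ (Fin m))), u ∈ P.U := ht
      simpa using norm_integral_le_of_norm_le_const (hmem.mono fun u hu => hf t htT x y u hu)) P.ξ
  refine ⟨x, hν.measurable, ?_, hi x hx, hxe⟩
  exact hν.compl.mono fun t ht => Measure.support_subset_of_isClosed hU.isClosed ht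

variable {z : Pair n m}

/-! ### Existence and uniqueness of the costate -/

section Costate

theorem IsCostate.continuousOn {p : ℝ → EuclideanSpace ℝ (Fin n)} (hp : P.IsCostate z p)
    (hT : 0 ≤ P.T) : ContinuousOn p (Icc 0 P.T) :=
  continuousOn_of_eq_add_integral_left hT hp.integrable hp.costate

/-- The exceptional null set of times does not depend on `p`. This uniformity is what both the
Picard argument and the uniqueness argument need. -/
theorem norm_adjointField_le (hz : P.IsFeasible z) (hP : P.LipschitzDifferentiable) :
    ∃ L : ℝ, 0 < L ∧ ∀ᵐ s ∂(volume.restrict (Icc 0 P.T)), ∀ p,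
      ‖(∫ u, ContinuousLinearMap.adjoint (P.dfx s (z.1 s) u)
        ∂(z.2 s : Measure (EuclideanSpace ℝ (Fin m)))) p‖ ≤ L * ‖p‖ := by
  obtain ⟨L, hL, -, -, hd, -⟩ := hP.exists_bounds
  refine ⟨L, hL, ?_⟩
  filter_upwards [hz.isControl.ae_norm_integral_le
    (φ := fun s u => ContinuousLinearMap.adjoint (P.dfx s (z.1 s) u)) (c := fun _ => L)
    fun s hs u hu => (LinearIsometryEquiv.norm_map _ _).trans_le (hd s hs _ u hu)] with s hs p
  exact (ContinuousLinearMap.le_opNorm _ _).trans (by gcongr)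

theorem intervalIntegrable_adjointField (hz : P.IsFeasible z) (hT : 0 ≤ P.T)
    (hU : IsCompact P.U) (hP : P.LipschitzDifferentiable) {p : ℝ → EuclideanSpace ℝ (Fin n)}
    (hp : ContinuousOn p (Icc 0 P.T)) : IntervalIntegrable (P.adjointField z p) volume 0 P.T := by
  have hA : ContinuousOn (Function.uncurry fun t u =>
      ContinuousLinearMap.adjoint (P.dfx t (z.1 t) u)) (Icc 0 P.T ×ˢ P.U) :=
    ContinuousLinearMap.adjoint.continuous.comp_continuousOn
      (hP.continuousOn_dfx (hz.continuousOn hT))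
  have hp' : ContinuousOn (fun y : ℝ × EuclideanSpace ℝ (Fin m) => p y.1)
      (Icc 0 P.T ×ˢ P.U) := hp.comp continuousOn_fst fun y hy => hy.1
  -- Moving `p(t)` under the integral turns the field into an average of a continuous vector-valued
  -- integrand.
  refine (hz.isControl.intervalIntegrable_integral hT hU
    (φ := fun t u => ContinuousLinearMap.adjoint (P.dfx t (z.1 t) u) (p t))
    (hA.clm_apply hp')).congr_ae_Icc hT ?_
  filter_upwards [hz.isControl.ae_integrable hU hA] with t ht
  exact (ContinuousLinearMap.integral_apply ht _).symm

theorem exists_isCostate (hz : P.IsFeasible z) (hT : 0 ≤ P.T) (hU : IsCompact P.U)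
    (hP : P.LipschitzDifferentiable) : ∃ p, P.IsCostate z p := by
  obtain ⟨L, hL, hA⟩ := norm_adjointField_le hz hP
  obtain ⟨p, hpc, hp⟩ := exists_integral_solution_backward hT hL
    (F := fun s p => (∫ u, ContinuousLinearMap.adjoint (P.dfx s (z.1 s) u)
        ∂(z.2 s : Measure (EuclideanSpace ℝ (Fin m)))) p)
    (fun x hx => intervalIntegrable_adjointField hz hT hU hP hx.continuousOn)
    (hA.mono fun s hs x y => by rw [← map_sub]; exact hs _) (gradient P.Ψ (z.1 P.T))
  exact ⟨p, intervalIntegrable_adjointField hz hT hU hP hpc.continuousOn, hp⟩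

/-- Grönwall in the reversed time `T - t`, with constant term `0` because both costates have the
same terminal value. -/
theorem IsCostate.eqOn (hz : P.IsFeasible z) (hT : 0 ≤ P.T) (hP : P.LipschitzDifferentiable)
    {p q : ℝ → EuclideanSpace ℝ (Fin n)} (hp : P.IsCostate z p) (hq : P.IsCostate z q) :
    EqOn q p (Icc 0 P.T) := by
  obtain ⟨L, hL, hA⟩ := norm_adjointField_le hz hP
  have hc : ContinuousOn (fun t => ‖q t - p t‖) (Icc 0 P.T) :=
    ((hq.continuousOn hT).sub (hp.continuousOn hT)).norm
  have hmap : MapsTo (fun t => P.T - t) (Icc 0 P.T) (Icc 0 P.T) := fun t ht =>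
    ⟨by linarith [ht.2], by linarith [ht.1]⟩
  have hci : IntervalIntegrable (fun s => L * ‖q s - p s‖) volume 0 P.T :=
    (continuousOn_const.mul hc).intervalIntegrable_of_Icc hT
  have key := le_mul_exp_of_le_add_integral (c := 0) (K := L) hT
    (u := fun t => ‖q (P.T - t) - p (P.T - t)‖)
    (hc.comp (f := fun t => P.T - t) (by fun_prop) hmap) (fun t _ => norm_nonneg _) hL.le
    (fun t ht => by
      have htm := hmap ht
      have h0 : (P.T : ℝ) ∈ Icc 0 P.T := ⟨hT, le_rfl⟩
      have h1 := intervalIntegral.integral_comp_sub_left (fun s => ‖q s - p s‖) P.T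
        (a := 0) (b := t)
      simp only at h1 htm
      rw [h1, sub_zero, zero_add, hq.costate _ htm, hp.costate _ htm, add_sub_add_left_eq_sub,
        ← intervalIntegral.integral_sub (hq.integrable.mono_Icc htm h0)
          (hp.integrable.mono_Icc htm h0), ← intervalIntegral.integral_const_mul]
      refine intervalIntegral.norm_integral_le_of_norm_le htm.2 ?_ (hci.mono_Icc htm h0)
      filter_upwards [(ae_restrict_iff' measurableSet_Icc).1 hA] with s hs hst
      rw [adjointField, adjointField, ← map_sub]
      exact hs ⟨htm.1.trans hst.1.le, hst.2⟩ _)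
  intro t ht
  have := key (P.T - t) (hmap ht)
  simp only [sub_sub_cancel, zero_mul, norm_le_zero_iff, sub_eq_zero] at this
  exact this

theorem isCostate_costate (hz : P.IsFeasible z) (hT : 0 ≤ P.T) (hU : IsCompact P.U)
    (hP : P.LipschitzDifferentiable) : P.IsCostate z (P.costate z) := by
  have h := exists_isCostate hz hT hU hP
  rw [costate, dif_pos h]
  exact h.choose_spec

end Costate

/-! ### Admissible variations as differences of controls -/

section Variation

variable {μ ν : ℝ → ProbabilityMeasure (EuclideanSpace ℝ (Fin m))}

/-- The signed measures `ν_t - μ_t`. -/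
noncomputable def diffProcess (ν μ : ℝ → ProbabilityMeasure (EuclideanSpace ℝ (Fin m))) (t : ℝ) :
    SignedMeasure (EuclideanSpace ℝ (Fin m)) :=
  (ν t : Measure (EuclideanSpace ℝ (Fin m))).toSignedMeasure -
    (μ t : Measure (EuclideanSpace ℝ (Fin m))).toSignedMeasure

theorem IsControl.isAdmissibleVariation (hν : P.IsControl ν) (hμ : P.IsControl μ)
    (hU : IsCompact P.U) : P.IsAdmissibleVariation μ (diffProcess ν μ) where
  measurable s hs := by
    have hreal : ∀ {ρ : ℝ → ProbabilityMeasure (EuclideanSpace ℝ (Fin m))}, P.IsControl ρ →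
        AEMeasurable (fun t => (ρ t : Measure (EuclideanSpace ℝ (Fin m))).real s)
          (volume.restrict (Icc 0 P.T)) := fun hρ =>
      ((Measure.measurable_coe hs).comp_aemeasurable hρ.measurable).ennreal_toReal
    refine ((hreal hν).sub (hreal hμ)).congr (ae_of_all _ fun t => ?_)
    exact (Measure.toSignedMeasure_sub_apply hs).symm
  support := by
    filter_upwards [hν.compl] with t ht
    rw [diffProcess, sub_add_cancel, Measure.variation_toSignedMeasure]
    exact Measure.support_subset_of_isClosed hU.isClosed ht
  nonneg := ae_of_all _ fun t => by
    rw [diffProcess, sub_add_cancel]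
    exact Measure.zero_le_toSignedMeasure _
  mass := ae_of_all _ fun t => by
    rw [diffProcess, Measure.toSignedMeasure_sub_apply MeasurableSet.univ]
    simp

/-- The control is `δμ + μ` itself: for a.e. time it is a nonnegative signed measure of mass one,
that is, a probability measure. -/
theorem IsAdmissibleVariation.exists_isControl
    {δμ : ℝ → SignedMeasure (EuclideanSpace ℝ (Fin m))} (h : P.IsAdmissibleVariation μ δμ)
    (hμ : P.IsControl μ) : ∃ ν, P.IsControl ν ∧
      ∀ᵐ t ∂(volume.restrict (Icc 0 P.T)), δμ t = diffProcess ν μ t := by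
  classical
  -- A nonnegative signed measure equals its total variation, which is defined at every time and is
  -- also the measure in the support condition.
  set ρ : ℝ → Measure (EuclideanSpace ℝ (Fin m)) := fun t =>
    (δμ t + (μ t : Measure (EuclideanSpace ℝ (Fin m))).toSignedMeasure).variation with hρ
  have hpos : ∀ᵐ t ∂(volume.restrict (Icc 0 P.T)), ∃ _ : IsProbabilityMeasure (ρ t),
      (ρ t).toSignedMeasure =
        δμ t + (μ t : Measure (EuclideanSpace ℝ (Fin m))).toSignedMeasure := by
    filter_upwards [h.nonneg, h.mass] with t ht htm
    set σ := δμ t + (μ t : Measure (EuclideanSpace ℝ (Fin m))).toSignedMeasure with hσ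
    have hσ0 := (VectorMeasure.le_restrict_univ_iff_le 0 σ).2 ht
    have hτ := σ.toMeasureOfZeroLE_toSignedMeasure hσ0
    have hτρ : σ.toMeasureOfZeroLE univ MeasurableSet.univ hσ0 = ρ t := by
      rw [hρ]
      simp only
      rw [← hσ]
      conv_rhs => rw [← hτ, Measure.variation_toSignedMeasure]
    have hu : σ univ = 1 := by
      rw [hσ, _root_.add_apply, htm, Measure.toSignedMeasure_apply_measurable .univ]
      simp
    have hprob : IsProbabilityMeasure (ρ t) := by
      rw [← hτρ]
      constructor
      rw [SignedMeasure.toMeasureOfZeroLE_apply _ hσ0 _ MeasurableSet.univ]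
      simp [hu]
    refine ⟨hprob, ?_⟩
    rw [← hτ]
    exact Measure.toSignedMeasure_congr hτρ.symm
  -- A default for the null set of times at which `ρ t` may fail to be a probability measure; it
  -- need not be carried by `U`.
  set y₀ : ProbabilityMeasure (EuclideanSpace ℝ (Fin m)) := ⟨Measure.dirac 0, inferInstance⟩
  set ν : ℝ → ProbabilityMeasure (EuclideanSpace ℝ (Fin m)) := fun t =>
    if h : IsProbabilityMeasure (ρ t) then ⟨ρ t, h⟩ else y₀ with hν
  have hνρ : ∀ t, IsProbabilityMeasure (ρ t) →
      (ν t : Measure (EuclideanSpace ℝ (Fin m))) = ρ t := fun t ht => by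
    have : ν t = ⟨ρ t, ht⟩ := dif_pos ht
    rw [this]
    rfl
  have hνδ : ∀ᵐ t ∂(volume.restrict (Icc 0 P.T)),
      (ν t : Measure (EuclideanSpace ℝ (Fin m))).toSignedMeasure =
        δμ t + (μ t : Measure (EuclideanSpace ℝ (Fin m))).toSignedMeasure := by
    filter_upwards [hpos] with t ⟨ht, ht'⟩
    rw [← ht']
    exact Measure.toSignedMeasure_congr (hνρ t ht)
  refine ⟨ν, ⟨?_, ?_⟩, ?_⟩
  · refine aemeasurable_measure_of_forall_measurableSet (ae_of_all _ fun _ => inferInstance)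
      fun s hs => ?_
    have hreal : AEMeasurable (fun t => (μ t : Measure (EuclideanSpace ℝ (Fin m))).real s)
        (volume.restrict (Icc 0 P.T)) :=
      ((Measure.measurable_coe hs).comp_aemeasurable hμ.measurable).ennreal_toReal
    refine (((h.measurable s hs).add hreal).ennreal_ofReal).congr ?_
    filter_upwards [hνδ] with t ht
    have := congrArg (fun σ : SignedMeasure (EuclideanSpace ℝ (Fin m)) => σ s) ht
    simp only [_root_.add_apply, Measure.toSignedMeasure_apply_measurable hs] at this
    rw [Pi.add_apply, ← this, ofReal_measureReal]
  · filter_upwards [hpos, h.support] with t ⟨ht, _⟩ hts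
    rw [hνρ t ht]
    exact measure_compl_eq_zero_of_support_subset hts
  · filter_upwards [hνδ] with t ht
    rw [diffProcess, ht, add_sub_cancel_right]

theorem integral_diffProcess {F : Type*} [NormedAddCommGroup F] [NormedSpace ℝ F]
    {g : EuclideanSpace ℝ (Fin m) → F} {t : ℝ}
    (hν : Integrable g (ν t : Measure (EuclideanSpace ℝ (Fin m))))
    (hμ : Integrable g (μ t : Measure (EuclideanSpace ℝ (Fin m)))) :
    ∫ᵛ u, g u ∂<•(diffProcess ν μ t) =
      ∫ u, g u ∂(ν t : Measure (EuclideanSpace ℝ (Fin m))) -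
        ∫ u, g u ∂(μ t : Measure (EuclideanSpace ℝ (Fin m))) := by
  rw [diffProcess, VectorMeasure.integral_sub_vectorMeasure, VectorMeasure.integral_toSignedMeasure,
    VectorMeasure.integral_toSignedMeasure]
  · rwa [VectorMeasure.Integrable, Measure.variation_toSignedMeasure]
  · rwa [VectorMeasure.Integrable, Measure.variation_toSignedMeasure]

theorem IsAdmissibleVariation.exists_integral_eq
    {δμ : ℝ → SignedMeasure (EuclideanSpace ℝ (Fin m))} (h : P.IsAdmissibleVariation μ δμ)
    (hμ : P.IsControl μ) (hU : IsCompact P.U) : ∃ ν, P.IsControl ν ∧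
      ∀ {F : Type} [NormedAddCommGroup F] [NormedSpace ℝ F]
        {φ : ℝ → EuclideanSpace ℝ (Fin m) → F},
        ContinuousOn (Function.uncurry φ) (Icc 0 P.T ×ˢ P.U) →
        ∀ᵐ t ∂(volume.restrict (Icc 0 P.T)), ∫ᵛ u, φ t u ∂<•(δμ t) =
          ∫ u, φ t u ∂(ν t : Measure (EuclideanSpace ℝ (Fin m))) -
            ∫ u, φ t u ∂(μ t : Measure (EuclideanSpace ℝ (Fin m))) := by
  obtain ⟨ν, hν, hδ⟩ := h.exists_isControl hμ
  refine ⟨ν, hν, fun hφ => ?_⟩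
  filter_upwards [hδ, hν.ae_integrable hU hφ, hμ.ae_integrable hU hφ] with t ht h1 h2
  rw [ht, integral_diffProcess h1 h2]

end Variation

/-! ### Equality of the two value sets and attainment of the minimum -/

section Values

theorem inner_gradient_eq_fderiv {E : Type*} [NormedAddCommGroup E] [InnerProductSpace ℝ E]
    [CompleteSpace E] (Ψ : E → ℝ) (x v : E) : inner ℝ (gradient Ψ x) v = fderiv ℝ Ψ x v := by
  rw [gradient, InnerProductSpace.toDual_symm_apply]

/-- The adjoint identity for a solution of the linearized equation. -/
theorem IsLinearizedTrajectory.fderiv_cost_eq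
    {δμ : ℝ → SignedMeasure (EuclideanSpace ℝ (Fin m))} {δx p : ℝ → EuclideanSpace ℝ (Fin n)}
    (hx : P.IsLinearizedTrajectory z δμ δx) (hz : P.IsFeasible z) (hT : 0 ≤ P.T)
    (hU : IsCompact P.U) (hP : P.LipschitzDifferentiable) (hp : P.IsCostate z p) :
    fderiv ℝ P.Ψ (z.1 P.T) (δx P.T) = ∫ t in 0..P.T, P.hamiltonian t (z.1 t) (δμ t) (p t) := by
  rw [← inner_gradient_eq_fderiv, (inner_integral_eq_integral_inner_sub hT hx.integrable
    hp.integrable hx.trajectory hp.costate).2]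
  refine intervalIntegral_congr_ae_Icc ?_ ⟨hT, le_rfl⟩
  filter_upwards [hz.isControl.ae_integrable hU (hP.continuousOn_dfx (hz.continuousOn hT))]
    with t ht
  rw [adjointField, inner_integral_adjoint_apply ht, linearizedField, inner_add_right,
    add_sub_cancel_left, hamiltonian]

theorem IsAdmissibleVariation.exists_isLinearizedTrajectory
    {δμ : ℝ → SignedMeasure (EuclideanSpace ℝ (Fin m))} (h : P.IsAdmissibleVariation z.2 δμ)
    (hz : P.IsFeasible z) (hT : 0 ≤ P.T) (hU : IsCompact P.U) (hP : P.LipschitzDifferentiable) :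
    ∃ δx, P.IsLinearizedTrajectory z δμ δx := by
  obtain ⟨L, hL, -, -, hd, -⟩ := hP.exists_bounds
  have hzc := hz.continuousOn hT
  -- Replacing `δμ` by `ν - μ` reduces integrability of the forcing term to that of averages over
  -- two controls.
  obtain ⟨ν, hν, hδ⟩ := h.exists_integral_eq hz.isControl hU
  have hw : IntervalIntegrable (fun s => ∫ᵛ u, P.f s (z.1 s) u ∂<•(δμ s)) volume 0 P.T :=
    ((hν.intervalIntegrable_integral hT hU (hP.continuousOn_f hzc)).sub
      (hz.isControl.intervalIntegrable_integral hT hU (hP.continuousOn_f hzc))).congr_ae_Icc hT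
      ((hδ (hP.continuousOn_f hzc)).mono fun t ht => ht.symm)
  have hi : ∀ x : ℝ → EuclideanSpace ℝ (Fin n), Continuous x →
      IntervalIntegrable (P.linearizedField z δμ x) volume 0 P.T := fun x hx => by
    have hA := hP.continuousOn_dfx hzc
    refine IntervalIntegrable.add ((hz.isControl.intervalIntegrable_integral hT hU
      (φ := fun t u => P.dfx t (z.1 t) u (x t))
      (hA.clm_apply (hx.comp continuous_fst).continuousOn)).congr_ae_Icc hT ?_) hw
    filter_upwards [hz.isControl.ae_integrable hU hA] with t ht
    exact (ContinuousLinearMap.integral_apply ht _).symm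
  obtain ⟨x, hx, hxe⟩ := exists_integral_solution hT hL
    (F := fun s x => (∫ u, P.dfx s (z.1 s) u ∂(z.2 s : Measure (EuclideanSpace ℝ (Fin m)))) x
      + ∫ᵛ u, P.f s (z.1 s) u ∂<•(δμ s)) hi (by
      filter_upwards [hz.isControl.ae_norm_integral_le
        (φ := fun s u => P.dfx s (z.1 s) u) (c := fun _ => L)
        fun s hs u hu => hd s hs _ u hu] with s hs x y
      rw [add_sub_add_right_eq_sub, ← map_sub]
      exact (ContinuousLinearMap.le_opNorm _ _).trans (by gcongr)) 0
  exact ⟨x, hi x hx, fun t ht => by rw [hxe t ht, zero_add]; rfl⟩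

/-- The adjoint identity equates the objectives for each `δμ`; existence of linearized trajectories
ensures that the first problem excludes no admissible `δμ`. -/
theorem valuesL_eq_valuesH (hz : P.IsFeasible z) (hT : 0 ≤ P.T) (hU : IsCompact P.U)
    (hP : P.LipschitzDifferentiable) : P.valuesL z = P.valuesH z := by
  have hp := isCostate_costate hz hT hU hP
  ext v
  constructor
  · rintro ⟨δx, δμ, hδ, hx, rfl⟩
    exact ⟨δμ, hδ, hx.fderiv_cost_eq hz hT hU hP hp⟩
  · rintro ⟨δμ, hδ, rfl⟩
    obtain ⟨δx, hx⟩ := hδ.exists_isLinearizedTrajectory hz hT hU hP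
    exact ⟨δx, δμ, hδ, hx, (hx.fderiv_cost_eq hz hT hU hP hp).symm⟩

/-- The integrand `p(t)ᵀ f(t, x(t), u)` of the Hamiltonian. -/
noncomputable def pairing (P : ControlProblem n m) (z : Pair n m) (t : ℝ)
    (u : EuclideanSpace ℝ (Fin m)) : ℝ := inner ℝ (P.costate z t) (P.f t (z.1 t) u)

theorem continuousOn_pairing (hz : P.IsFeasible z) (hT : 0 ≤ P.T) (hU : IsCompact P.U)
    (hP : P.LipschitzDifferentiable) :
    ContinuousOn (Function.uncurry (P.pairing z)) (Icc 0 P.T ×ˢ P.U) := by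
  have hp : ContinuousOn (fun y : ℝ × EuclideanSpace ℝ (Fin m) => P.costate z y.1)
      (Icc 0 P.T ×ˢ P.U) :=
    ((isCostate_costate hz hT hU hP).continuousOn hT).comp continuousOn_fst fun y hy => hy.1
  exact hp.inner (hP.continuousOn_f (hz.continuousOn hT))

/-- The value of the variation `ν - μ`. -/
noncomputable def variationValue (P : ControlProblem n m) (z : Pair n m)
    (ν : ℝ → ProbabilityMeasure (EuclideanSpace ℝ (Fin m))) : ℝ :=
  ∫ t in 0..P.T, (∫ u, P.pairing z t u ∂(ν t : Measure (EuclideanSpace ℝ (Fin m))) -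
    ∫ u, P.pairing z t u ∂(z.2 t : Measure (EuclideanSpace ℝ (Fin m))))

theorem inner_integral_sub_eq (hz : P.IsFeasible z) (hT : 0 ≤ P.T) (hU : IsCompact P.U)
    (hP : P.LipschitzDifferentiable) {ν : ℝ → ProbabilityMeasure (EuclideanSpace ℝ (Fin m))}
    (hν : P.IsControl ν) : ∀ᵐ t ∂(volume.restrict (Icc 0 P.T)),
      inner ℝ (P.costate z t) (∫ u, P.f t (z.1 t) u ∂(ν t : Measure (EuclideanSpace ℝ (Fin m))) -
        ∫ u, P.f t (z.1 t) u ∂(z.2 t : Measure (EuclideanSpace ℝ (Fin m)))) =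
      ∫ u, P.pairing z t u ∂(ν t : Measure (EuclideanSpace ℝ (Fin m))) -
        ∫ u, P.pairing z t u ∂(z.2 t : Measure (EuclideanSpace ℝ (Fin m))) := by
  have hf := hP.continuousOn_f (hz.continuousOn hT)
  filter_upwards [hν.ae_integrable hU hf, hz.isControl.ae_integrable hU hf] with t h1 h2
  rw [inner_sub_right, ← integral_inner h1, ← integral_inner h2]
  rfl

/-- The minimization becomes one over controls with a scalar integrand: the costate moves inside the
average of `f`. -/
theorem valuesH_eq (hz : P.IsFeasible z) (hT : 0 ≤ P.T) (hU : IsCompact P.U)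
    (hP : P.LipschitzDifferentiable) :
    P.valuesH z = {v | ∃ ν, P.IsControl ν ∧ v = P.variationValue z ν} := by
  have hf := hP.continuousOn_f (hz.continuousOn hT)
  ext v
  constructor
  · rintro ⟨δμ, hδ, rfl⟩
    obtain ⟨ν, hν, hδν⟩ := hδ.exists_integral_eq hz.isControl hU
    refine ⟨ν, hν, intervalIntegral_congr_ae_Icc ?_ ⟨hT, le_rfl⟩⟩
    filter_upwards [hδν hf, inner_integral_sub_eq hz hT hU hP hν] with t h1 h2
    rw [hamiltonian, h1, h2]
  · rintro ⟨ν, hν, rfl⟩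
    refine ⟨diffProcess ν z.2, hν.isAdmissibleVariation hz.isControl hU,
      intervalIntegral_congr_ae_Icc ?_ ⟨hT, le_rfl⟩⟩
    filter_upwards [hν.ae_integrable hU hf, hz.isControl.ae_integrable hU hf,
      inner_integral_sub_eq hz hT hU hP hν] with t h1 h2 h3
    rw [hamiltonian, integral_diffProcess h1 h2, h3]

/-- At each time an average of `pᵀ f` over `U` is at least its minimum, and the Dirac mass at a
minimizer achieves it. Measurable selection makes these masses a control. -/
theorem exists_isLeast_valuesH (hz : P.IsFeasible z) (hT : 0 ≤ P.T) (hU : IsCompact P.U)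
    (hne : P.U.Nonempty) (hP : P.LipschitzDifferentiable) : ∃ v, IsLeast (P.valuesH z) v := by
  have hφ := continuousOn_pairing hz hT hU hP
  obtain ⟨s, hs, hsU, hmin⟩ := exists_measurable_argmin hT hU hne hφ
  have hσ : P.IsControl fun t => ⟨Measure.dirac (s t), inferInstance⟩ := by
    refine ⟨(Measure.measurable_dirac.comp hs).aemeasurable, ae_of_all _ fun t => ?_⟩
    change Measure.dirac (s t) P.Uᶜ = 0
    rw [Measure.dirac_apply' _ hU.measurableSet.compl]
    simp [hsU t]
  rw [valuesH_eq hz hT hU hP]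
  refine ⟨_, ⟨_, hσ, rfl⟩, ?_⟩
  rintro _ ⟨ν, hν, rfl⟩
  have hi := fun {ρ} (hρ : P.IsControl ρ) => (hρ.intervalIntegrable_integral hT hU hφ).sub
    (hz.isControl.intervalIntegrable_integral hT hU hφ)
  refine intervalIntegral.integral_mono_ae_restrict hT (hi hσ) (hi hν) ?_
  filter_upwards [hν.compl, hν.ae_integrable hU hφ, ae_restrict_mem measurableSet_Icc]
    with t ht hti htT
  refine sub_le_sub_right ?_ _
  change ∫ u, P.pairing z t u ∂(Measure.dirac (s t)) ≤ _
  rw [integral_dirac]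
  have hmem : ∀ᵐ u ∂(ν t : Measure (EuclideanSpace ℝ (Fin m))), u ∈ P.U := ht
  have := integral_mono_ae (integrable_const (P.pairing z t (s t))) hti
    (hmem.mono fun u hu => hmin t htT u hu)
  simpa using this

theorem zero_mem_valuesH (hz : P.IsFeasible z) (hT : 0 ≤ P.T) (hU : IsCompact P.U)
    (hP : P.LipschitzDifferentiable) : 0 ∈ P.valuesH z := by
  rw [valuesH_eq hz hT hU hP]
  exact ⟨z.2, hz.isControl, by simp [variationValue]⟩

end Values

/-! ### First-order expansion under convex perturbation of the control -/

section Perturbation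

/-- The convex combination `(1 - ε) μ + ε ν` of two controls is a control. -/
theorem IsControl.exists_convex_combination
    {μ ν : ℝ → ProbabilityMeasure (EuclideanSpace ℝ (Fin m))} (hμ : P.IsControl μ)
    (hν : P.IsControl ν) {ε : ℝ} (hε : ε ∈ Icc 0 1) : ∃ ρ, P.IsControl ρ ∧
      ∀ t, ∀ g : EuclideanSpace ℝ (Fin m) → EuclideanSpace ℝ (Fin n),
        Integrable g (μ t : Measure (EuclideanSpace ℝ (Fin m))) →
        Integrable g (ν t : Measure (EuclideanSpace ℝ (Fin m))) →
        ∫ u, g u ∂(ρ t : Measure (EuclideanSpace ℝ (Fin m))) =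
          (1 - ε) • ∫ u, g u ∂(μ t : Measure (EuclideanSpace ℝ (Fin m))) +
            ε • ∫ u, g u ∂(ν t : Measure (EuclideanSpace ℝ (Fin m))) := by
  have hε' : 0 ≤ 1 - ε := by linarith [hε.2]
  set ρ : ℝ → Measure (EuclideanSpace ℝ (Fin m)) := fun t =>
    ENNReal.ofReal (1 - ε) • (μ t : Measure (EuclideanSpace ℝ (Fin m))) +
      ENNReal.ofReal ε • (ν t : Measure (EuclideanSpace ℝ (Fin m))) with hρ
  have happ : ∀ t s, ρ t s = ENNReal.ofReal (1 - ε) * (μ t : Measure _) s +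
      ENNReal.ofReal ε * (ν t : Measure _) s := fun t s => by
    simp [hρ]
  have hprob : ∀ t, IsProbabilityMeasure (ρ t) := fun t => ⟨by
    rw [happ, measure_univ, measure_univ, mul_one, mul_one, ← ENNReal.ofReal_add hε' hε.1]
    simp⟩
  refine ⟨fun t => ⟨ρ t, hprob t⟩, ⟨?_, ?_⟩, fun t g h1 h2 => ?_⟩
  · refine aemeasurable_measure_of_forall_measurableSet (ae_of_all _ hprob)
      fun s hs => ?_
    change AEMeasurable (fun t => ρ t s) _
    simp_rw [happ]
    exact (((Measure.measurable_coe hs).comp_aemeasurable hμ.measurable).const_mul _).add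
      (((Measure.measurable_coe hs).comp_aemeasurable hν.measurable).const_mul _)
  · filter_upwards [hμ.compl, hν.compl] with t h1 h2
    change ρ t P.Uᶜ = 0
    rw [happ, h1, h2]
    simp
  · change ∫ u, g u ∂(ρ t) = _
    rw [hρ, integral_add_measure (h1.smul_measure ENNReal.ofReal_ne_top)
      (h2.smul_measure ENNReal.ofReal_ne_top), integral_smul_measure, integral_smul_measure,
      ENNReal.toReal_ofReal hε', ENNReal.toReal_ofReal hε.1]

/-- The averages of `f` over the input set differ by a bounded amount. -/
theorem IsControl.ae_norm_integral_sub_le (hU : IsCompact P.U) (hne : P.U.Nonempty)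
    (hP : P.LipschitzDifferentiable) : ∃ B : ℝ, 0 ≤ B ∧
      ∀ {μ ν : ℝ → ProbabilityMeasure (EuclideanSpace ℝ (Fin m))}, P.IsControl μ → P.IsControl ν →
      ∀ {x : ℝ → EuclideanSpace ℝ (Fin n)}, ContinuousOn x (Icc 0 P.T) →
      ∀ᵐ t ∂(volume.restrict (Icc 0 P.T)),
        ‖∫ u, P.f t (x t) u ∂(ν t : Measure (EuclideanSpace ℝ (Fin m))) -
          ∫ u, P.f t (x t) u ∂(μ t : Measure (EuclideanSpace ℝ (Fin m)))‖ ≤ B := by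
  obtain ⟨L, hL, -, -, -, -, hu⟩ := hP.exists_bounds
  obtain ⟨u₀, hu₀⟩ := hne
  obtain ⟨D, hD⟩ := hU.isBounded.subset_closedBall u₀
  have hD0 : 0 ≤ D := by simpa using dist_nonneg.trans (hD hu₀)
  -- Subtracting the value at a fixed `u₀` makes the bound independent of the state: `f` may grow
  -- with `x`, but its variation over `U` is at most `L * D`, counted once for each measure.
  refine ⟨2 * (L * D), by positivity, fun {μ ν} hμ hν {x} hx => ?_⟩
  have hf := hP.continuousOn_f hx
  have hb : ∀ t ∈ Icc 0 P.T, ∀ u ∈ P.U, ‖P.f t (x t) u - P.f t (x t) u₀‖ ≤ L * D :=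
    fun t ht u huU => (hu t ht _ u huU u₀ hu₀).trans (by
      gcongr
      simpa [dist_eq_norm] using hD huU)
  filter_upwards [hμ.ae_integrable hU hf, hν.ae_integrable hU hf, hμ.ae_norm_integral_le hb,
    hν.ae_norm_integral_le hb] with t h1 h2 h3 h4
  rw [integral_sub h1 (integrable_const _)] at h3
  rw [integral_sub h2 (integrable_const _)] at h4
  simp only [integral_const, probReal_univ, one_smul] at h3 h4
  calc _ = ‖(∫ u, P.f t (x t) u ∂(ν t : Measure (EuclideanSpace ℝ (Fin m))) -
            P.f t (x t) u₀) - (∫ u, P.f t (x t) u ∂(μ t : Measure (EuclideanSpace ℝ (Fin m))) -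
            P.f t (x t) u₀)‖ := by rw [sub_sub_sub_cancel_right]
    _ ≤ _ := (norm_sub_le _ _).trans (by linarith)

/-- The first-order expansion of the cost along a convex perturbation of the control. -/
theorem exists_cost_le (hz : P.IsFeasible z) (hT : 0 ≤ P.T) (hU : IsCompact P.U)
    (hne : P.U.Nonempty) (hP : P.LipschitzDifferentiable)
    {ν : ℝ → ProbabilityMeasure (EuclideanSpace ℝ (Fin m))} (hν : P.IsControl ν) :
    ∃ C : ℝ, ∀ ε ∈ Icc (0 : ℝ) 1, ∃ w, P.IsFeasible w ∧
      P.cost w ≤ P.cost z + ε * P.variationValue z ν + C * ε ^ 2 := by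
  obtain ⟨B, hB0, hB⟩ := IsControl.ae_norm_integral_sub_le hU hne hP
  obtain ⟨L, hL, hΨ, hf, -, hf2, -⟩ := hP.exists_bounds
  have hμ := hz.isControl
  have hzc := hz.continuousOn hT
  have hp := isCostate_costate hz hT hU hP
  obtain ⟨M, hM⟩ := isCompact_Icc.exists_bound_of_continuousOn (hp.continuousOn hT)
  have h0T : (0 : ℝ) ∈ Icc 0 P.T := ⟨le_rfl, hT⟩
  have hTT : P.T ∈ Icc 0 P.T := ⟨hT, le_rfl⟩
  have hM0 : 0 ≤ M := (norm_nonneg _).trans (hM 0 h0T)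
  -- `ε * K` is the Grönwall bound on the displacement of the trajectory: the change of control
  -- contributes a forcing of size `ε * B`.
  set K := B * P.T * Real.exp (L * P.T) with hK
  have hK0 : 0 ≤ K := by positivity
  -- The first term is the remainder of the dynamics, paired with a costate of norm at most `M` and
  -- integrated over `[0,T]`; the second is the Taylor remainder of `Ψ`.
  refine ⟨M * (L * K ^ 2 + 2 * L * K) * P.T + L * K ^ 2, fun ε hε => ?_⟩
  have hε0 : 0 ≤ ε := hε.1
  obtain ⟨ρ, hρ, hρi⟩ := hμ.exists_convex_combination (n := n) hν hε
  obtain ⟨x, hw⟩ := hρ.exists_isFeasible hT hU hP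
  refine ⟨(x, ρ), hw, ?_⟩
  have hxc : ContinuousOn x (Icc 0 P.T) := hw.continuousOn hT
  set e : ℝ → EuclideanSpace ℝ (Fin n) := fun t => x t - z.1 t with he
  set g : ℝ → EuclideanSpace ℝ (Fin n) := fun t =>
    ∫ u, P.f t (x t) u ∂(ρ t : Measure (EuclideanSpace ℝ (Fin m))) -
      ∫ u, P.f t (z.1 t) u ∂(z.2 t : Measure (EuclideanSpace ℝ (Fin m))) with hg
  have hgi : IntervalIntegrable g volume 0 P.T := hw.integrable.sub hz.integrable
  have heg : ∀ t ∈ Icc 0 P.T, e t = ∫ s in 0..t, g s := fun t ht => by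
    rw [intervalIntegral.integral_sub (hw.integrable.mono_Icc h0T ht)
      (hz.integrable.mono_Icc h0T ht)]
    have hxt : x t = _ := hw.trajectory t ht
    simp only [he]
    rw [hxt, hz.trajectory t ht, add_sub_add_left_eq_sub]
  have hfx := hP.continuousOn_f hxc
  have hfz := hP.continuousOn_f hzc
  have hec : ContinuousOn (fun t => ‖e t‖) (Icc 0 P.T) := (hxc.sub hzc).norm
  have hdiff : ∀ t ∈ Icc 0 P.T, ∀ u ∈ P.U, ‖P.f t (x t) u - P.f t (z.1 t) u‖ ≤ L * ‖e t‖ :=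
    fun t ht u hu => hf t ht _ _ u hu
  have hgle : ∀ᵐ t ∂(volume.restrict (Icc 0 P.T)), ‖g t‖ ≤ L * ‖e t‖ + ε * B := by
    filter_upwards [hμ.ae_integrable hU hfx, hμ.ae_integrable hU hfz, hν.ae_integrable hU hfx,
      hμ.ae_norm_integral_le hdiff, hB hμ hν hxc] with t h1 h2 h3 h4 h5
    have : g t = (∫ u, (P.f t (x t) u - P.f t (z.1 t) u)
        ∂(z.2 t : Measure (EuclideanSpace ℝ (Fin m)))) +
        ε • (∫ u, P.f t (x t) u ∂(ν t : Measure (EuclideanSpace ℝ (Fin m))) -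
          ∫ u, P.f t (x t) u ∂(z.2 t : Measure (EuclideanSpace ℝ (Fin m)))) := by
      simp only [hg]
      rw [hρi t _ h1 h3, integral_sub h1 h2]
      module
    rw [this]
    refine (norm_add_le _ _).trans (add_le_add h4 ?_)
    rw [norm_smul, Real.norm_of_nonneg hε0]
    gcongr
  have heK : ∀ t ∈ Icc 0 P.T, ‖e t‖ ≤ ε * K := by
    have := le_mul_exp_of_le_add_integral (c := ε * B * P.T) hT hec (fun t _ => norm_nonneg _)
      hL.le fun t ht => by
        have hci : IntervalIntegrable (fun s => L * ‖e s‖) volume 0 t :=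
          ((continuousOn_const.mul hec).intervalIntegrable_of_Icc hT).mono_Icc h0T ht
        rw [heg t ht]
        refine (norm_intervalIntegral_le_of_ae_Icc hgle ht
          (hci.add intervalIntegrable_const)).trans ?_
        rw [intervalIntegral.integral_add hci intervalIntegrable_const,
          intervalIntegral.integral_const_mul, intervalIntegral.integral_const, sub_zero,
          smul_eq_mul, add_comm]
        have : t * (ε * B) ≤ ε * B * P.T := by
          rw [mul_comm]
          exact mul_le_mul_of_nonneg_left ht.2 (by positivity)
        linarith
    intro t ht
    refine (this t ht).trans ?_
    rw [hK, ← mul_assoc, ← mul_assoc]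
    gcongr
    exact ht.2
  obtain ⟨hdi, hdual⟩ := inner_integral_eq_integral_inner_sub hT hgi hp.integrable heg hp.costate
  have hpair := continuousOn_pairing hz hT hU hP
  have hvi : IntervalIntegrable (fun t =>
      ∫ u, P.pairing z t u ∂(ν t : Measure (EuclideanSpace ℝ (Fin m))) -
      ∫ u, P.pairing z t u ∂(z.2 t : Measure (EuclideanSpace ℝ (Fin m)))) volume 0 P.T :=
    (hν.intervalIntegrable_integral hT hU hpair).sub
      (hμ.intervalIntegrable_integral hT hU hpair)
  have hmain : ∀ᵐ t ∂(volume.restrict (Icc 0 P.T)),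
      inner ℝ (P.costate z t) (g t) - inner ℝ (P.adjointField z (P.costate z) t) (e t) ≤
        ε * (∫ u, P.pairing z t u ∂(ν t : Measure (EuclideanSpace ℝ (Fin m))) -
          ∫ u, P.pairing z t u ∂(z.2 t : Measure (EuclideanSpace ℝ (Fin m)))) +
        M * (L * K ^ 2 + 2 * L * K) * ε ^ 2 := by
    have hA := hP.continuousOn_dfx hzc
    have hrem : ∀ t ∈ Icc 0 P.T, ∀ u ∈ P.U,
        ‖P.f t (x t) u - P.f t (z.1 t) u - P.dfx t (z.1 t) u (e t)‖ ≤ L * ‖e t‖ ^ 2 :=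
      fun t ht u hu => hf2 t ht _ _ u hu
    filter_upwards [hμ.ae_integrable hU hfx, hμ.ae_integrable hU hfz, hν.ae_integrable hU hfx,
      hν.ae_integrable hU hfz, hμ.ae_integrable hU hA, hμ.ae_norm_integral_le hdiff,
      hν.ae_norm_integral_le hdiff, hμ.ae_norm_integral_le hrem,
      inner_integral_sub_eq hz hT hU hP hν, ae_restrict_mem measurableSet_Icc]
      with t i1 i2 i3 i4 i5 b1 b2 b3 hin htT
    rw [adjointField, inner_integral_adjoint_apply i5, ← inner_sub_right, ← hin]
    have i12 : Integrable (fun u => P.f t (x t) u - P.f t (z.1 t) u)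
        (z.2 t : Measure (EuclideanSpace ℝ (Fin m))) := i1.sub i2
    rw [integral_sub i12 (i5.apply_continuousLinearMap _), integral_sub i1 i2,
      ← ContinuousLinearMap.integral_apply i5] at b3
    rw [integral_sub i1 i2] at b1
    rw [integral_sub i3 i4] at b2
    simp only [hg]
    rw [hρi t _ i1 i3]
    set a := ∫ u, P.f t (x t) u ∂(z.2 t : Measure (EuclideanSpace ℝ (Fin m)))
    set b := ∫ u, P.f t (z.1 t) u ∂(z.2 t : Measure (EuclideanSpace ℝ (Fin m)))
    set c := ∫ u, P.f t (x t) u ∂(ν t : Measure (EuclideanSpace ℝ (Fin m)))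
    set d := ∫ u, P.f t (z.1 t) u ∂(ν t : Measure (EuclideanSpace ℝ (Fin m)))
    set A := (∫ u, P.dfx t (z.1 t) u ∂(z.2 t : Measure (EuclideanSpace ℝ (Fin m)))) (e t)
    -- The three pieces are the first-order effect of the new control along the old trajectory, the
    -- Taylor remainder in the state, and a cross term that is `ε` times an `O(ε)` displacement. The
    -- last two are `O(ε²)`.
    have hsplit : (1 - ε) • a + ε • c - b - A =
        ε • (d - b) + ((a - b - A) + ε • ((c - d) - (a - b))) := by module
    rw [hsplit, inner_add_right, inner_smul_right]
    gcongr
    have hn : ‖(a - b - A) + ε • ((c - d) - (a - b))‖ ≤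
        L * (ε * K) ^ 2 + ε * (L * (ε * K) + L * (ε * K)) := by
      refine (norm_add_le _ _).trans ?_
      rw [norm_smul, Real.norm_of_nonneg hε0]
      have hek := heK t htT
      have h1 : L * ‖e t‖ ^ 2 ≤ L * (ε * K) ^ 2 := by gcongr
      have h2 : L * ‖e t‖ ≤ L * (ε * K) := by gcongr
      refine add_le_add (b3.trans h1) ?_
      gcongr
      exact (norm_sub_le _ _).trans (add_le_add (b2.trans h2) (b1.trans h2))
    calc _ ≤ ‖P.costate z t‖ * ‖(a - b - A) + ε • ((c - d) - (a - b))‖ := real_inner_le_norm _ _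
      _ ≤ M * (L * (ε * K) ^ 2 + ε * (L * (ε * K) + L * (ε * K))) := by
          gcongr
          exact hM t htT
      _ = _ := by ring
  have hint := intervalIntegral.integral_mono_ae_restrict hT hdi
    ((hvi.const_mul ε).add intervalIntegrable_const) hmain
  rw [← hdual, intervalIntegral.integral_add (hvi.const_mul ε) intervalIntegrable_const,
    intervalIntegral.integral_const_mul, intervalIntegral.integral_const, sub_zero, smul_eq_mul,
    inner_gradient_eq_fderiv] at hint
  have h1 := (abs_le.1 (hΨ (z.1 P.T) (x P.T))).2
  have h2 : L * ‖x P.T - z.1 P.T‖ ^ 2 ≤ L * (ε * K) ^ 2 := by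
    gcongr
    exact heK _ hTT
  change fderiv ℝ P.Ψ (z.1 P.T) (x P.T - z.1 P.T) ≤ ε * P.variationValue z ν + _ at hint
  change P.Ψ (x P.T) ≤ P.Ψ (z.1 P.T) + _ + _
  nlinarith

/-- Optimality and the expansion give `0 ≤ ε v + C ε²`; divide by `ε > 0` and let `ε` tend to `0`.
-/
theorem nonneg_of_isMinOn (hz : P.IsFeasible z) (hT : 0 ≤ P.T) (hU : IsCompact P.U)
    (hne : P.U.Nonempty) (hP : P.LipschitzDifferentiable)
    (hmin : IsMinOn P.cost P.feasibleSet z) {v : ℝ} (hv : v ∈ P.valuesH z) : 0 ≤ v := by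
  rw [valuesH_eq hz hT hU hP] at hv
  obtain ⟨ν, hν, rfl⟩ := hv
  obtain ⟨C, hC⟩ := exists_cost_le hz hT hU hne hP hν
  have key : ∀ ε ∈ Ioc (0 : ℝ) 1, 0 ≤ P.variationValue z ν + C * ε := fun ε hε => by
    obtain ⟨w, hw, hle⟩ := hC ε ⟨hε.1.le, hε.2⟩
    have hzw : P.cost z ≤ P.cost w := hmin hw
    have : 0 ≤ ε * (P.variationValue z ν + C * ε) := by nlinarith
    exact nonneg_of_mul_nonneg_right this hε.1
  have hlim : Filter.Tendsto (fun ε : ℝ => P.variationValue z ν + C * ε)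
      (nhdsWithin 0 (Ioi 0)) (nhds (P.variationValue z ν)) := by
    have : Continuous fun ε : ℝ => P.variationValue z ν + C * ε := by fun_prop
    have h := this.tendsto 0
    simp only [mul_zero, add_zero] at h
    exact h.mono_left nhdsWithin_le_nhds
  exact ge_of_tendsto hlim (Filter.eventually_of_mem (Ioc_mem_nhdsGT one_pos) key)

end Perturbation

end ControlProblem

/-! ### Assembly of the theorem -/

theorem mainTheorem5 {n m : ℕ} (P : ControlProblem n m) (hT : 0 < P.T)
    (hUconn : IsConnected P.U) (hUcomp : IsCompact P.U) (hP : P.LipschitzDifferentiable) :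
    -- the costate is well defined on `[0,T]`, and the minima defining the two functions exist
    (∀ z ∈ P.feasibleSet,
      (P.IsCostate z (P.costate z) ∧
        ∀ q, P.IsCostate z q → EqOn q (P.costate z) (Icc 0 P.T)) ∧
      IsLeast (P.valuesL z) (P.thetaL z) ∧
      IsLeast (P.valuesH z) (P.thetaH z)) ∧
    IsOptimalityFunction P.feasibleSet P.cost P.thetaL ∧
    IsOptimalityFunction P.feasibleSet P.cost P.thetaH := by
  have hne := hUconn.nonempty
  have hLH : ∀ z ∈ P.feasibleSet, P.thetaL z = P.thetaH z := fun z hz => by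
    rw [ControlProblem.thetaL, ControlProblem.thetaH,
      ControlProblem.valuesL_eq_valuesH hz hT.le hUcomp hP]
  have hH : ∀ z ∈ P.feasibleSet, IsLeast (P.valuesH z) (P.thetaH z) := fun z hz => by
    obtain ⟨v, hv⟩ := ControlProblem.exists_isLeast_valuesH hz hT.le hUcomp hne hP
    rwa [ControlProblem.thetaH, hv.csInf_eq]
  have hopt : IsOptimalityFunction P.feasibleSet P.cost P.thetaH := by
    have hle : ∀ z ∈ P.feasibleSet, P.thetaH z ≤ 0 := fun z hz =>
      (hH z hz).2 (ControlProblem.zero_mem_valuesH hz hT.le hUcomp hP)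
    exact ⟨hle, fun z hz hmin => le_antisymm (hle z hz)
      (ControlProblem.nonneg_of_isMinOn hz hT.le hUcomp hne hP hmin (hH z hz).1)⟩
  refine ⟨fun z hz => ⟨?_, ?_, hH z hz⟩, ?_, hopt⟩
  · have hp := ControlProblem.isCostate_costate hz hT.le hUcomp hP
    exact ⟨hp, fun q hq => hp.eqOn hz hT.le hP hq⟩
  · rw [hLH z hz, ControlProblem.valuesL_eq_valuesH hz hT.le hUcomp hP]
    exact hH z hz
  · exact ⟨fun z hz => (hLH z hz).trans_le (hopt.1 z hz),
      fun z hz hmin => (hLH z hz).trans (hopt.2 z hz hmin)⟩
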